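/- **Theorem (uniform $d$-dimensional Gnedenko local theorem).** Let $F$ be a probability distribution on $\mathbb Z^d$ that is aperiodic, i.e. the subgroup of $\mathbb Z^d$ generated by $\operatorname{supp}(F)-\operatorname{supp}(F)$ is $\mathbb Z^d$, where $\operatorname{supp}(F)=\{x: F(x)>0\}$. Let $\varphi(\theta)=\log\sum_{x\in\mathbb Z^d}e^{\langle\theta,x\rangle}F(x)\in(-\infty,+\infty]$, $\theta\in\mathbb R^d$, be its log-Laplace transform, and assume that the interior $\mathcal I_F$ of $\{\theta\in\mathbb R^d:\varphi(\theta)<\infty\}$ is non-empty. For $\theta\in\mathcal I_F$ let $F_\theta(x)=e^{\langle\theta,x\rangle-\varphi(\theta)}F(x)$ be the exponentially tilted distribution, with mean vector $m_\theta$ and covariance matrix $\Sigma_\theta$, and let $\mathbb P_\theta$ be a probability measure under which $X_1,X_2,\dots$ are independent with distribution $F_\theta$; set $S_n=\sum_{\ell=1}^nX_\ell$. Then for every $\theta\in\mathcal I_F$ the distribution $F_\theta$ has finite second moments and $\Sigma_\theta$ is positive definite, and for every compact set $K\subset\mathcal I_F$, $$\lim_{n\to\infty}\ \sup_{\theta\in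 K}\ \sup_{s\in\mathbb Z^d}\left|\,n^{d/2}\,|\Sigma_\theta|^{1/2}\,\mathbb P_\theta(S_n=s)-(2\pi)^{-d/2}e^{-\|z_n(\theta,s)\|^2/2}\right|=0,$$ where $|\Sigma_\theta|$ is the determinant of $\Sigma_\theta$, $\|\cdot\|$ is the Euclidean norm, $z_n(\theta,s)=n^{-1/2}\,\Sigma_\theta^{-1/2}(s-n\,m_\theta)$, and $\Sigma_\theta^{-1/2}$ is the inverse of the positive definite square root of $\Sigma_\theta$. -/

import Mathlib

open MeasureTheory ProbabilityTheory Filter Topology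
open scoped ENNReal Pointwise MatrixOrder

namespace LocalLimit

/-- `F` is aperiodic: the subgroup of `ℤ^d` generated by `supp F - supp F` is all of `ℤ^d`. -/
def Aperiodic {d : ℕ} (F : PMF (Fin d → ℤ)) : Prop :=
  AddSubgroup.closure (F.support - F.support) = ⊤

/-- The inclusion of `ℤ^d` in the Euclidean space `ℝ^d`. -/
def toEuclid {d : ℕ} (x : Fin d → ℤ) : EuclideanSpace ℝ (Fin d) :=
  WithLp.toLp 2 (fun i => (x i : ℝ))

/-- The log-Laplace transform `φ(θ) = log E[exp ⟨θ, X⟩]`, with values in `(-∞, +∞]`. -/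
noncomputable def logLaplace {d : ℕ} (F : PMF (Fin d → ℤ)) (θ : EuclideanSpace ℝ (Fin d)) :
    EReal :=
  ENNReal.log (∫⁻ x, ENNReal.ofReal (Real.exp (inner ℝ θ (toEuclid x))) ∂F.toMeasure)

/-- The interior of the domain `{θ | φ(θ) < +∞}` of the log-Laplace transform. -/
def interiorDom {d : ℕ} (F : PMF (Fin d → ℤ)) : Set (EuclideanSpace ℝ (Fin d)) :=
  interior {θ | logLaplace F θ < ⊤}

/-- The exponentially tilted law `F_θ(dx) = exp (⟨θ, x⟩ - φ(θ)) F(dx)`. -/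
noncomputable def tiltedLaw {d : ℕ} (F : PMF (Fin d → ℤ)) (θ : EuclideanSpace ℝ (Fin d)) :
    Measure (Fin d → ℤ) :=
  F.toMeasure.tilted (fun x => inner ℝ θ (toEuclid x))

/-- The mean vector `m_θ` of the tilted law. -/
noncomputable def mean {d : ℕ} (F : PMF (Fin d → ℤ)) (θ : EuclideanSpace ℝ (Fin d)) :
    EuclideanSpace ℝ (Fin d) :=
  ∫ x, toEuclid x ∂(tiltedLaw F θ)

/-- The covariance matrix `Σ_θ` of the tilted law. -/
noncomputable def covMatrix {d : ℕ} (F : PMF (Fin d → ℤ)) (θ : EuclideanSpace ℝ (Fin d)) :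
    Matrix (Fin d) (Fin d) ℝ :=
  Matrix.of fun i j =>
    covariance (fun x : Fin d → ℤ => (x i : ℝ)) (fun x : Fin d → ℤ => (x j : ℝ)) (tiltedLaw F θ)

/-- The normalized vector `z_n(θ, s) = n^{-1/2} Σ_θ^{-1/2} (s - n m_θ)`, where `Σ_θ^{-1/2}` is the
inverse of the positive semidefinite square root of `Σ_θ`. -/
noncomputable def zVec {d : ℕ} (F : PMF (Fin d → ℤ)) (n : ℕ) (θ : EuclideanSpace ℝ (Fin d))
    (s : Fin d → ℤ) : EuclideanSpace ℝ (Fin d) :=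
  (n : ℝ) ^ (-(1 / 2) : ℝ) •
    Matrix.toEuclideanLin (CFC.sqrt (covMatrix F θ))⁻¹ (toEuclid s - (n : ℝ) • mean F θ)

end LocalLimit

namespace LocalLimit

variable {d : ℕ}

/-! Fourier inversion writes `(2π)^d P(S_n = s)` as the integral over `[-π, π]^d` of the `n`-th
power of the centered characteristic function times a phase depending on `s`. After the substitution
`u = t / √n`, the Gaussian term is the integral over `ℝ^d` of `exp (-⟨t, Σ t⟩ / 2)` against the same
phase. Since the phase has modulus one, the error is at most `|Σ|^{1/2}` times the `L¹` distance
`charFunError`, uniformly in `s` (`abs_sub_le_charFunError`).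

That distance tends to zero by dominated convergence. Pointwise convergence is a second-order Taylor
expansion (`tendsto_centeredCharFun_pow`). The majorant is a bound `exp (-c |u|²)` for the
characteristic function on the whole cube (`exists_norm_centeredCharFun_le`); this is where
aperiodicity enters. Letting `n → ∞` in the same bound also shows that `Σ` is positive definite.

Uniformity in `θ` comes from taking limits jointly in `n → ∞` and `θ → θ₀`, which works because
nearby tilts are dominated by one integrable function (`exists_dominating`). Compactness of `K` then
turns local into uniform estimates. -/

/-- The `ℓ¹` norm of an integer vector. -/
def l1 (x : Fin d → ℤ) : ℝ := ∑ j, |(x j : ℝ)|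

lemma l1_nonneg (x : Fin d → ℤ) : 0 ≤ l1 x := Finset.sum_nonneg fun _ _ => abs_nonneg _

lemma abs_le_l1 (x : Fin d → ℤ) (j : Fin d) : |(x j : ℝ)| ≤ l1 x :=
  Finset.single_le_sum (f := fun j => |(x j : ℝ)|) (fun _ _ => abs_nonneg _) (Finset.mem_univ j)

@[fun_prop]
lemma measurable_of_discrete {E : Type*} [MeasurableSpace E] (f : (Fin d → ℤ) → E) :
    Measurable f := measurable_of_countable f

lemma inner_toEuclid (θ : EuclideanSpace ℝ (Fin d)) (x : Fin d → ℤ) :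
    inner ℝ θ (toEuclid x) = ∑ j, θ j * (x j : ℝ) := by
  simp [toEuclid, PiLp.inner_apply, mul_comm]

lemma norm_toEuclid_le (x : Fin d → ℤ) : ‖toEuclid x‖ ≤ l1 x := by
  rw [EuclideanSpace.norm_eq, Real.sqrt_le_left (l1_nonneg x)]
  simp only [toEuclid, Real.norm_eq_abs, l1]
  exact Finset.sum_sq_le_sq_sum_of_nonneg fun _ _ => abs_nonneg _

/-! ### Tilted laws: domination, moments and continuity in the parameter. -/

lemma isOpen_interiorDom (F : PMF (Fin d → ℤ)) : IsOpen (interiorDom F) := isOpen_interior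

lemma logLaplace_lt_top_iff (F : PMF (Fin d → ℤ)) (θ : EuclideanSpace ℝ (Fin d)) :
    logLaplace F θ < ⊤ ↔
      Integrable (fun x => Real.exp (inner ℝ θ (toEuclid x))) F.toMeasure := by
  have hm : Measurable (fun x : Fin d → ℤ => Real.exp (inner ℝ θ (toEuclid x))) := by fun_prop
  rw [logLaplace, lt_top_iff_ne_top, Ne, ENNReal.log_eq_top_iff, ← Ne, ← lt_top_iff_ne_top,
    ← hasFiniteIntegral_iff_ofReal (ae_of_all _ fun x => (Real.exp_pos _).le)]
  exact ⟨fun h => ⟨hm.aestronglyMeasurable, h⟩, fun h => h.2⟩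

lemma integrable_exp_of_mem (F : PMF (Fin d → ℤ)) {θ : EuclideanSpace ℝ (Fin d)}
    (hθ : θ ∈ interiorDom F) :
    Integrable (fun x => Real.exp (inner ℝ θ (toEuclid x))) F.toMeasure :=
  (logLaplace_lt_top_iff F θ).1
    (interior_subset (s := {θ | logLaplace F θ < ⊤}) hθ)

lemma isProbabilityMeasure_tiltedLaw (F : PMF (Fin d → ℤ)) {θ : EuclideanSpace ℝ (Fin d)}
    (hθ : θ ∈ interiorDom F) : IsProbabilityMeasure (tiltedLaw F θ) :=
  isProbabilityMeasure_tilted (integrable_exp_of_mem F hθ)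

/-- Near an interior point of the domain, polynomials times the tilting densities are dominated by
a single integrable function. -/
lemma exists_dominating (F : PMF (Fin d → ℤ)) {θ₀ : EuclideanSpace ℝ (Fin d)}
    (hθ : θ₀ ∈ interiorDom F) (k : ℕ) :
    ∃ H : (Fin d → ℤ) → ℝ, Integrable H F.toMeasure ∧
      ∀ᶠ θ in 𝓝 θ₀, ∀ x, (1 + l1 x) ^ k * Real.exp (inner ℝ θ (toEuclid x)) ≤ H x := by
  -- Finitely many sign vectors suffice: if `σ` is the sign pattern of `x`, moving `θ₀` by `r • w σ`
  -- raises the exponent by exactly `r * l1 x`.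
  let w : (Fin d → SignType) → EuclideanSpace ℝ (Fin d) :=
    fun σ => WithLp.toLp 2 (fun j => ((σ j : ℤ) : ℝ))
  have hev : ∀ᶠ r : ℝ in 𝓝[>] 0, ∀ σ, θ₀ + r • w σ ∈ interiorDom F := by
    refine Eventually.filter_mono nhdsWithin_le_nhds ?_
    rw [eventually_all]
    intro σ
    have hc : ContinuousAt (fun r : ℝ => θ₀ + r • w σ) 0 := by fun_prop
    refine hc.eventually_mem ?_
    simpa using (isOpen_interiorDom F).mem_nhds hθ
  obtain ⟨r, hr, hr0⟩ := (hev.and self_mem_nhdsWithin).exists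
  replace hr0 : 0 < r := hr0
  -- The gain `r * l1 x` is spent in halves: one pays for replacing `θ₀` by `θ`, the other for the
  -- polynomial, through `y ^ k / k! ≤ exp y`.
  refine ⟨fun x => (k.factorial * (2 / r) ^ k * Real.exp (r / 2)) *
    ∑ σ, Real.exp (inner ℝ (θ₀ + r • w σ) (toEuclid x)), ?_, ?_⟩
  · exact (integrable_finsetSum _ fun σ _ => integrable_exp_of_mem F (hr σ)).const_mul _
  · have hnear : ∀ᶠ θ in 𝓝 θ₀, ∀ j, |θ j - θ₀ j| < r / 2 := by
      rw [eventually_all]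
      intro j
      have hc : ContinuousAt (fun θ : EuclideanSpace ℝ (Fin d) => |θ j - θ₀ j|) θ₀ := by fun_prop
      exact hc.eventually_lt_const (by simpa using hr0)
    filter_upwards [hnear] with θ hθn x
    have hN := l1_nonneg x
    have h1 : (1 + l1 x) ^ k ≤
        k.factorial * (2 / r) ^ k * Real.exp (r / 2) * Real.exp (r / 2 * l1 x) := by
      have := Real.pow_div_factorial_le_exp (x := r / 2 * (1 + l1 x)) (by positivity) k
      rw [div_le_iff₀ (by positivity), mul_pow] at this
      have e : Real.exp (r / 2 * (1 + l1 x)) = Real.exp (r / 2) * Real.exp (r / 2 * l1 x) := by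
        rw [← Real.exp_add]; ring_nf
      rw [e] at this
      calc (1 + l1 x) ^ k = (2 / r) ^ k * ((r / 2) ^ k * (1 + l1 x) ^ k) := by
            rw [← mul_assoc, ← mul_pow]; field_simp; simp
        _ ≤ (2 / r) ^ k * (Real.exp (r / 2) * Real.exp (r / 2 * l1 x) * k.factorial) := by gcongr
        _ = _ := by ring
    let σ : Fin d → SignType := fun j => SignType.sign (x j)
    have h2 : r / 2 * l1 x + inner ℝ θ (toEuclid x) ≤ inner ℝ (θ₀ + r • w σ) (toEuclid x) := by
      rw [inner_toEuclid, inner_toEuclid, l1, Finset.mul_sum, ← Finset.sum_add_distrib]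
      refine Finset.sum_le_sum fun j _ => ?_
      have hs : ((σ j : ℤ) : ℝ) * (x j : ℝ) = |(x j : ℝ)| := by
        have := sign_mul_self (x j)
        simp only [σ]
        rw [← Int.cast_abs, ← this]
        push_cast; rfl
      have hb : (θ j - θ₀ j) * x j ≤ r / 2 * |(x j : ℝ)| := by
        refine (le_abs_self _).trans ?_
        rw [abs_mul]
        exact mul_le_mul_of_nonneg_right (hθn j).le (abs_nonneg _)
      have : (θ₀ + r • w σ) j * (x j : ℝ) = θ₀ j * x j + r * |(x j : ℝ)| := by
        rw [← hs]; simp [w]; ring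
      rw [this]; linarith
    calc (1 + l1 x) ^ k * Real.exp (inner ℝ θ (toEuclid x))
        ≤ k.factorial * (2 / r) ^ k * Real.exp (r / 2) * Real.exp (r / 2 * l1 x) *
          Real.exp (inner ℝ θ (toEuclid x)) := by gcongr
      _ = k.factorial * (2 / r) ^ k * Real.exp (r / 2) *
          Real.exp (r / 2 * l1 x + inner ℝ θ (toEuclid x)) := by rw [Real.exp_add]; ring
      _ ≤ k.factorial * (2 / r) ^ k * Real.exp (r / 2) *
          Real.exp (inner ℝ (θ₀ + r • w σ) (toEuclid x)) := by gcongr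
      _ ≤ _ := by
        gcongr
        exact Finset.single_le_sum
          (f := fun σ => Real.exp (inner ℝ (θ₀ + r • w σ) (toEuclid x)))
          (fun _ _ => (Real.exp_pos _).le) (Finset.mem_univ σ)

/-- Functions of polynomial growth are integrable with respect to the tilted laws. -/
lemma integrable_tiltedLaw {E : Type*} [NormedAddCommGroup E] [NormedSpace ℝ E]
    [MeasurableSpace E] [BorelSpace E] [SecondCountableTopology E]
    (F : PMF (Fin d → ℤ)) {θ : EuclideanSpace ℝ (Fin d)} (hθ : θ ∈ interiorDom F)
    (f : (Fin d → ℤ) → E) (C : ℝ) (k : ℕ) (hf : ∀ x, ‖f x‖ ≤ C * (1 + l1 x) ^ k) :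
    Integrable f (tiltedLaw F θ) := by
  rw [tiltedLaw, integrable_tilted_iff (integrable_exp_of_mem F hθ)]
  obtain ⟨H, hH, hdom⟩ := exists_dominating F hθ k
  have hC : 0 ≤ C := by
    have := (norm_nonneg _).trans (hf 0)
    simpa [l1] using this
  refine (hH.const_mul C).mono' (by fun_prop) (ae_of_all _ fun x => ?_)
  rw [norm_smul, Real.norm_eq_abs, Real.abs_exp]
  calc _ ≤ Real.exp (inner ℝ θ (toEuclid x)) * (C * (1 + l1 x) ^ k) := by gcongr; exact hf x
    _ = C * ((1 + l1 x) ^ k * Real.exp (inner ℝ θ (toEuclid x))) := by ring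
    _ ≤ _ := by gcongr; exact hdom.self_of_nhds x

/-- The unnormalized form: taking `f = 1` gives the normalizing constant, so a quotient of two
instances treats the tilted law itself. -/
lemma tendsto_integral_exp_smul {E : Type*} [NormedAddCommGroup E] [NormedSpace ℝ E]
    [MeasurableSpace E] [BorelSpace E] [SecondCountableTopology E]
    (F : PMF (Fin d → ℤ)) {θ₀ : EuclideanSpace ℝ (Fin d)} (hθ : θ₀ ∈ interiorDom F)
    {ι : Type*} {l : Filter ι} [l.IsCountablyGenerated]
    {τ : ι → EuclideanSpace ℝ (Fin d)} (hτ : Tendsto τ l (𝓝 θ₀))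
    {f : ι → (Fin d → ℤ) → E} {g : (Fin d → ℤ) → E} (C : ℝ) (k : ℕ)
    (hf : ∀ᶠ i in l, ∀ x, ‖f i x‖ ≤ C * (1 + l1 x) ^ k)
    (hfg : ∀ x, Tendsto (fun i => f i x) l (𝓝 (g x))) :
    Tendsto (fun i => ∫ x, Real.exp (inner ℝ (τ i) (toEuclid x)) • f i x ∂F.toMeasure) l
      (𝓝 (∫ x, Real.exp (inner ℝ θ₀ (toEuclid x)) • g x ∂F.toMeasure)) := by
  obtain ⟨H, hH, hdom⟩ := exists_dominating F hθ k
  refine tendsto_integral_filter_of_dominated_convergence (fun x => |C| * H x) ?_ ?_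
    (hH.const_mul _) ?_
  · exact Eventually.of_forall fun i => Measurable.aestronglyMeasurable (by fun_prop)
  · filter_upwards [hτ.eventually hdom, hf] with i hi hfi
    refine ae_of_all _ fun x => ?_
    have := l1_nonneg x
    rw [norm_smul, Real.norm_eq_abs, Real.abs_exp]
    calc _ ≤ Real.exp (inner ℝ (τ i) (toEuclid x)) * (|C| * (1 + l1 x) ^ k) := by
          gcongr
          exact (hfi x).trans (by gcongr; exact le_abs_self C)
      _ = |C| * ((1 + l1 x) ^ k * Real.exp (inner ℝ (τ i) (toEuclid x))) := by ring
      _ ≤ _ := by gcongr; exact hi x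
  · refine ae_of_all _ fun x => Tendsto.smul ?_ (hfg x)
    have hc : Continuous fun θ : EuclideanSpace ℝ (Fin d) =>
      Real.exp (inner ℝ θ (toEuclid x)) := by fun_prop
    exact (hc.tendsto θ₀).comp hτ

/-- Dominated convergence for expectations under tilted laws with converging parameters. -/
lemma tendsto_integral_tiltedLaw {E : Type*} [NormedAddCommGroup E] [NormedSpace ℝ E]
    [MeasurableSpace E] [BorelSpace E] [SecondCountableTopology E]
    (F : PMF (Fin d → ℤ)) {θ₀ : EuclideanSpace ℝ (Fin d)} (hθ : θ₀ ∈ interiorDom F)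
    {ι : Type*} {l : Filter ι} [l.IsCountablyGenerated]
    {τ : ι → EuclideanSpace ℝ (Fin d)} (hτ : Tendsto τ l (𝓝 θ₀))
    {f : ι → (Fin d → ℤ) → E} {g : (Fin d → ℤ) → E} (C : ℝ) (k : ℕ)
    (hf : ∀ᶠ i in l, ∀ x, ‖f i x‖ ≤ C * (1 + l1 x) ^ k)
    (hfg : ∀ x, Tendsto (fun i => f i x) l (𝓝 (g x))) :
    Tendsto (fun i => ∫ x, f i x ∂tiltedLaw F (τ i)) l (𝓝 (∫ x, g x ∂tiltedLaw F θ₀)) := by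
  have hZ := tendsto_integral_exp_smul F hθ hτ (f := fun _ _ => (1 : ℝ)) (g := fun _ => 1) 1 0
    (by simp) (fun _ => tendsto_const_nhds)
  simp only [smul_eq_mul, mul_one] at hZ
  have hpos : 0 < ∫ x, Real.exp (inner ℝ θ₀ (toEuclid x)) ∂F.toMeasure :=
    integral_exp_pos (integrable_exp_of_mem F hθ)
  have e : ∀ (θ : EuclideanSpace ℝ (Fin d)) (h : (Fin d → ℤ) → E),
      ∫ x, h x ∂tiltedLaw F θ = (∫ x, Real.exp (inner ℝ θ (toEuclid x)) ∂F.toMeasure)⁻¹ •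
        ∫ x, Real.exp (inner ℝ θ (toEuclid x)) • h x ∂F.toMeasure := by
    intro θ h
    rw [tiltedLaw, integral_tilted, ← integral_smul]
    simp_rw [smul_smul, div_eq_inv_mul]
  simp_rw [e]
  exact (hZ.inv₀ hpos.ne').smul (tendsto_integral_exp_smul F hθ hτ C k hf hfg)

lemma tiltedLaw_singleton_pos (F : PMF (Fin d → ℤ)) {θ : EuclideanSpace ℝ (Fin d)}
    (hθ : θ ∈ interiorDom F) {x : Fin d → ℤ} (hx : x ∈ F.support) :
    0 < (tiltedLaw F θ).real {x} := by
  have := isProbabilityMeasure_tiltedLaw F hθ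
  rw [measureReal_def, ENNReal.toReal_pos_iff]
  refine ⟨pos_iff_ne_zero.2 fun h => ?_, measure_lt_top _ _⟩
  have h0 : F.toMeasure {x} = 0 := absolutelyContinuous_tilted (integrable_exp_of_mem F hθ) h
  rw [PMF.toMeasure_apply_singleton _ _ (measurableSet_singleton x)] at h0
  exact hx h0

lemma tendsto_tiltedLaw_singleton (F : PMF (Fin d → ℤ)) {θ₀ : EuclideanSpace ℝ (Fin d)}
    (hθ : θ₀ ∈ interiorDom F) (x : Fin d → ℤ) :
    Tendsto (fun θ => (tiltedLaw F θ).real {x}) (𝓝 θ₀) (𝓝 ((tiltedLaw F θ₀).real {x})) := by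
  have := tendsto_integral_tiltedLaw F hθ tendsto_id
    (f := fun _ => Set.indicator {x} (fun _ => (1 : ℝ))) (g := Set.indicator {x} fun _ => (1 : ℝ))
    1 0 (by
      refine Eventually.of_forall fun _ y => ?_
      by_cases h : y ∈ ({x} : Set (Fin d → ℤ)) <;> simp [h]) (fun _ => tendsto_const_nhds)
  simpa only [integral_indicator_const _ (measurableSet_singleton x), smul_eq_mul, mul_one, id]
    using this

lemma integrable_toEuclid (F : PMF (Fin d → ℤ)) {θ : EuclideanSpace ℝ (Fin d)}
    (hθ : θ ∈ interiorDom F) : Integrable toEuclid (tiltedLaw F θ) :=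
  integrable_tiltedLaw F hθ _ 1 1 fun x => by linarith [norm_toEuclid_le x]

lemma memLp_toEuclid (F : PMF (Fin d → ℤ)) {θ : EuclideanSpace ℝ (Fin d)}
    (hθ : θ ∈ interiorDom F) : MemLp toEuclid 2 (tiltedLaw F θ) := by
  rw [memLp_two_iff_integrable_sq_norm (by fun_prop)]
  refine integrable_tiltedLaw F hθ _ 1 2 fun x => ?_
  rw [Real.norm_of_nonneg (by positivity), one_mul]
  gcongr
  linarith [norm_toEuclid_le x]

lemma mean_apply (F : PMF (Fin d → ℤ)) {θ : EuclideanSpace ℝ (Fin d)}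
    (hθ : θ ∈ interiorDom F) (j : Fin d) :
    mean F θ j = ∫ x, (x j : ℝ) ∂tiltedLaw F θ :=
  ((EuclideanSpace.proj j : EuclideanSpace ℝ (Fin d) →L[ℝ] ℝ).integral_comp_comm
    (integrable_toEuclid F hθ)).symm

lemma tendsto_mean (F : PMF (Fin d → ℤ)) {θ₀ : EuclideanSpace ℝ (Fin d)}
    (hθ : θ₀ ∈ interiorDom F) (j : Fin d) :
    Tendsto (fun θ => mean F θ j) (𝓝 θ₀) (𝓝 (mean F θ₀ j)) := by
  have := tendsto_integral_tiltedLaw F hθ tendsto_id (f := fun _ x => (x j : ℝ))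
    (g := fun x => (x j : ℝ)) 1 1
    (Eventually.of_forall fun _ x => by
      rw [Real.norm_eq_abs]; linarith [abs_le_l1 x j]) (fun _ => tendsto_const_nhds)
  rw [mean_apply F hθ]
  refine this.congr' ?_
  filter_upwards [(isOpen_interiorDom F).mem_nhds hθ] with θ h
  rw [mean_apply F h, id]

/-! ### Centered functionals, covariance and its quadratic form. -/

/-- The centered linear functional `x ↦ ⟨u, x - m_θ⟩`. -/
noncomputable def dev (F : PMF (Fin d → ℤ)) (θ : EuclideanSpace ℝ (Fin d)) (u : Fin d → ℝ)
    (x : Fin d → ℤ) : ℝ := ∑ j, u j * ((x j : ℝ) - mean F θ j)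

/-- The characteristic function of the centered tilted law. -/
noncomputable def centeredCharFun (F : PMF (Fin d → ℤ)) (θ : EuclideanSpace ℝ (Fin d))
    (u : Fin d → ℝ) : ℂ := ∫ x, Complex.exp (dev F θ u x * Complex.I) ∂tiltedLaw F θ

/-- The quadratic form `⟨u, Σ_θ u⟩`. -/
noncomputable def quad (F : PMF (Fin d → ℤ)) (θ : EuclideanSpace ℝ (Fin d)) (u : Fin d → ℝ) : ℝ :=
  u ⬝ᵥ (covMatrix F θ).mulVec u

lemma dev_smul (F : PMF (Fin d → ℤ)) (θ : EuclideanSpace ℝ (Fin d)) (c : ℝ) (u : Fin d → ℝ)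
    (x : Fin d → ℤ) : dev F θ (c • u) x = c * dev F θ u x := by
  simp [dev, Finset.mul_sum, mul_assoc]

lemma exists_center_bound (F : PMF (Fin d → ℤ)) {θ₀ : EuclideanSpace ℝ (Fin d)}
    (hθ : θ₀ ∈ interiorDom F) :
    ∃ M : ℝ, 0 ≤ M ∧ ∀ᶠ θ in 𝓝 θ₀, ∀ (x : Fin d → ℤ) j,
      |(x j : ℝ) - mean F θ j| ≤ M * (1 + l1 x) := by
  refine ⟨1 + ∑ i, (|mean F θ₀ i| + 1), by positivity, ?_⟩
  have : ∀ᶠ θ in 𝓝 θ₀, ∀ j, |mean F θ j| < |mean F θ₀ j| + 1 := by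
    rw [eventually_all]
    exact fun j => (tendsto_mean F hθ j).abs.eventually_lt_const (by linarith)
  filter_upwards [this] with θ h x j
  have h1 : |mean F θ₀ j| + 1 ≤ ∑ i, (|mean F θ₀ i| + 1) :=
    Finset.single_le_sum (f := fun i => |mean F θ₀ i| + 1) (fun _ _ => by positivity)
      (Finset.mem_univ j)
  have h2 := abs_le_l1 x j
  have h3 := abs_sub (x j : ℝ) (mean F θ j)
  have h4 := h j
  have h5 : 0 ≤ (∑ i, (|mean F θ₀ i| + 1)) * l1 x := by
    have := l1_nonneg x
    positivity
  nlinarith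

lemma exists_dev_bound (F : PMF (Fin d → ℤ)) {θ₀ : EuclideanSpace ℝ (Fin d)}
    (hθ : θ₀ ∈ interiorDom F) (u : Fin d → ℝ) :
    ∃ M : ℝ, 0 ≤ M ∧ ∀ᶠ θ in 𝓝 θ₀, ∀ x, |dev F θ u x| ≤ M * (1 + l1 x) := by
  obtain ⟨M, hM, h⟩ := exists_center_bound F hθ
  refine ⟨(∑ j, |u j|) * M, by positivity, ?_⟩
  filter_upwards [h] with θ h x
  rw [dev, mul_assoc, Finset.sum_mul]
  refine (Finset.abs_sum_le_sum_abs _ _).trans (Finset.sum_le_sum fun j _ => ?_)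
  rw [abs_mul]
  gcongr
  exact h x j

lemma integrable_dev (F : PMF (Fin d → ℤ)) {θ : EuclideanSpace ℝ (Fin d)}
    (hθ : θ ∈ interiorDom F) (u : Fin d → ℝ) : Integrable (dev F θ u) (tiltedLaw F θ) := by
  obtain ⟨M, -, h⟩ := exists_dev_bound F hθ u
  exact integrable_tiltedLaw F hθ _ M 1 fun x => by simpa using h.self_of_nhds x

lemma integrable_center (F : PMF (Fin d → ℤ)) {θ : EuclideanSpace ℝ (Fin d)}
    (hθ : θ ∈ interiorDom F) (j : Fin d) :
    Integrable (fun x : Fin d → ℤ => (x j : ℝ) - mean F θ j) (tiltedLaw F θ) := by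
  obtain ⟨M, -, h⟩ := exists_center_bound F hθ
  exact integrable_tiltedLaw F hθ _ M 1 fun x => by simpa using h.self_of_nhds x j

lemma integral_dev (F : PMF (Fin d → ℤ)) {θ : EuclideanSpace ℝ (Fin d)}
    (hθ : θ ∈ interiorDom F) (u : Fin d → ℝ) : ∫ x, dev F θ u x ∂tiltedLaw F θ = 0 := by
  have := isProbabilityMeasure_tiltedLaw F hθ
  simp only [dev]
  rw [integral_finsetSum _ fun j _ => (integrable_center F hθ j).const_mul _]
  refine Finset.sum_eq_zero fun j _ => ?_
  have hj : Integrable (fun x : Fin d → ℤ => (x j : ℝ)) (tiltedLaw F θ) :=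
    integrable_tiltedLaw F hθ _ 1 1 fun x => by
      rw [Real.norm_eq_abs]; linarith [abs_le_l1 x j]
  rw [integral_const_mul, integral_sub hj (integrable_const _), ← mean_apply F hθ]
  simp

lemma covMatrix_apply (F : PMF (Fin d → ℤ)) {θ : EuclideanSpace ℝ (Fin d)}
    (hθ : θ ∈ interiorDom F) (i j : Fin d) :
    covMatrix F θ i j =
      ∫ x, ((x i : ℝ) - mean F θ i) * ((x j : ℝ) - mean F θ j) ∂tiltedLaw F θ := by
  simp [covMatrix, covariance, mean_apply F hθ]

lemma tendsto_covMatrix (F : PMF (Fin d → ℤ)) {θ₀ : EuclideanSpace ℝ (Fin d)}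
    (hθ : θ₀ ∈ interiorDom F) :
    Tendsto (fun θ => covMatrix F θ) (𝓝 θ₀) (𝓝 (covMatrix F θ₀)) := by
  refine tendsto_pi_nhds.2 fun i => tendsto_pi_nhds.2 fun j => ?_
  obtain ⟨M, hM, h⟩ := exists_center_bound F hθ
  have := tendsto_integral_tiltedLaw F hθ tendsto_id
    (f := fun θ x => ((x i : ℝ) - mean F θ i) * ((x j : ℝ) - mean F θ j))
    (g := fun x => ((x i : ℝ) - mean F θ₀ i) * ((x j : ℝ) - mean F θ₀ j)) (M ^ 2) 2
    (by
      filter_upwards [h] with θ h x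
      have := l1_nonneg x
      rw [norm_mul, ← mul_pow, sq, Real.norm_eq_abs, Real.norm_eq_abs]
      exact mul_le_mul (h x i) (h x j) (abs_nonneg _) (by positivity))
    (fun x => (tendsto_const_nhds.sub (tendsto_mean F hθ i)).mul
      (tendsto_const_nhds.sub (tendsto_mean F hθ j)))
  rw [covMatrix_apply F hθ]
  refine this.congr' ?_
  filter_upwards [(isOpen_interiorDom F).mem_nhds hθ] with θ h
  rw [covMatrix_apply F h, id]

lemma quad_eq_integral (F : PMF (Fin d → ℤ)) {θ : EuclideanSpace ℝ (Fin d)}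
    (hθ : θ ∈ interiorDom F) (u : Fin d → ℝ) :
    quad F θ u = ∫ x, dev F θ u x ^ 2 ∂tiltedLaw F θ := by
  obtain ⟨M, hM, h⟩ := exists_center_bound F hθ
  have hint : ∀ i j, Integrable (fun x : Fin d → ℤ =>
      ((x i : ℝ) - mean F θ i) * ((x j : ℝ) - mean F θ j)) (tiltedLaw F θ) := fun i j =>
    integrable_tiltedLaw F hθ _ (M ^ 2) 2 fun x => by
      have := l1_nonneg x
      rw [norm_mul, ← mul_pow, sq, Real.norm_eq_abs, Real.norm_eq_abs]
      exact mul_le_mul (h.self_of_nhds x i) (h.self_of_nhds x j) (abs_nonneg _) (by positivity)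
  have e : ∀ x, dev F θ u x ^ 2 = ∑ i, ∑ j, u i * u j *
      (((x i : ℝ) - mean F θ i) * ((x j : ℝ) - mean F θ j)) := fun x => by
    rw [dev, sq, Finset.sum_mul_sum]
    exact Finset.sum_congr rfl fun i _ => Finset.sum_congr rfl fun j _ => by ring
  simp_rw [e]
  rw [integral_finsetSum _ fun i _ => integrable_finsetSum _ fun j _ => (hint i j).const_mul _]
  simp only [quad, dotProduct, Matrix.mulVec, Finset.mul_sum]
  refine Finset.sum_congr rfl fun i _ => ?_
  rw [integral_finsetSum _ fun j _ => (hint i j).const_mul _]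
  refine Finset.sum_congr rfl fun j _ => ?_
  rw [integral_const_mul, covMatrix_apply F hθ]
  ring

lemma continuous_quad_vec (F : PMF (Fin d → ℤ)) (θ : EuclideanSpace ℝ (Fin d)) :
    Continuous (quad F θ) := by
  unfold quad
  fun_prop

lemma tendsto_quad (F : PMF (Fin d → ℤ)) {θ₀ : EuclideanSpace ℝ (Fin d)}
    (hθ : θ₀ ∈ interiorDom F) (u : Fin d → ℝ) :
    Tendsto (fun θ => quad F θ u) (𝓝 θ₀) (𝓝 (quad F θ₀ u)) := by
  have hc : Continuous fun A : Matrix (Fin d) (Fin d) ℝ => u ⬝ᵥ A.mulVec u := by fun_prop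
  exact (hc.tendsto _).comp (tendsto_covMatrix F hθ)

/-! ### Taylor expansion of the characteristic function -/

/-- Valid for every `w`, this serves as the majorant; the cubic bound for `|w| ≤ 1` below identifies
the limit. -/
lemma norm_exp_sub_one_sub_le (w : ℝ) :
    ‖Complex.exp (w * Complex.I) - 1 - w * Complex.I‖ ≤ 3 * w ^ 2 := by
  rcases le_total |w| 1 with h | h
  · have := Complex.norm_exp_sub_one_sub_id_le (x := w * Complex.I) (by simpa using h)
    simp only [norm_mul, Complex.norm_real, Complex.norm_I, mul_one, Real.norm_eq_abs,
      sq_abs] at this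
    nlinarith [sq_nonneg w]
  · have h1 : ‖Complex.exp (w * Complex.I) - 1 - w * Complex.I‖ ≤ 1 + 1 + |w| := by
      refine (norm_sub_le _ _).trans (add_le_add ((norm_sub_le _ _).trans ?_) ?_)
      · simp [Complex.norm_exp_ofReal_mul_I]
      · simp
    nlinarith [sq_abs w]

lemma norm_exp_sub_quadratic_le {w : ℝ} (hw : |w| ≤ 1) :
    ‖Complex.exp (w * Complex.I) - 1 - w * Complex.I + (w : ℂ) ^ 2 / 2‖ ≤ |w| ^ 3 := by
  have := Complex.exp_bound (x := w * Complex.I) (by simpa using hw) (n := 3) (by norm_num)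
  simp only [Finset.sum_range_succ, Finset.sum_range_zero, norm_mul, Complex.norm_real,
    Complex.norm_I, mul_one, Real.norm_eq_abs, mul_pow, Complex.I_sq] at this
  norm_num [Nat.factorial] at this
  calc _ = ‖Complex.exp (w * Complex.I) - (1 + w * Complex.I + -(w : ℂ) ^ 2 / 2)‖ := by
        congr 1; ring
    _ ≤ _ := this
    _ ≤ _ := by nlinarith [pow_nonneg (abs_nonneg w) 3]

/-- If `n → ∞` and `y → y₀` then `n (e^{iy/√n} - 1 - iy/√n) → -y₀²/2`. -/
lemma tendsto_mul_exp_sub {ι : Type*} {l : Filter ι} {n : ι → ℕ} {y : ι → ℝ} {y₀ : ℝ}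
    (hn : Tendsto n l atTop) (hy : Tendsto y l (𝓝 y₀)) :
    Tendsto (fun i => (n i : ℂ) * (Complex.exp (((√(n i))⁻¹ * y i : ℝ) * Complex.I) - 1 -
      ((√(n i))⁻¹ * y i : ℝ) * Complex.I)) l (𝓝 (-(y₀ : ℂ) ^ 2 / 2)) := by
  have hs : Tendsto (fun i => (√(n i : ℝ))⁻¹) l (𝓝 0) :=
    tendsto_inv_atTop_zero.comp
      (Real.tendsto_sqrt_atTop.comp (tendsto_natCast_atTop_atTop.comp hn))
  have hw : Tendsto (fun i => |(√(n i : ℝ))⁻¹ * y i|) l (𝓝 0) := by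
    simpa using (hs.mul hy).abs
  have hb : Tendsto (fun i => (√(n i : ℝ))⁻¹ * |y i| ^ 3) l (𝓝 0) := by
    simpa using hs.mul (hy.abs.pow 3)
  -- With `w = y / √n` the cubic remainder contributes `n |w|³ = |y|³ / √n`, which is `hb`.
  have h0 : Tendsto (fun i => (n i : ℂ) * (Complex.exp (((√(n i))⁻¹ * y i : ℝ) * Complex.I) - 1 -
      ((√(n i))⁻¹ * y i : ℝ) * Complex.I) - -(y i : ℂ) ^ 2 / 2) l (𝓝 0) := by
    refine squeeze_zero_norm' ?_ hb
    filter_upwards [hw.eventually_le_const zero_lt_one, hn.eventually_ge_atTop 1] with i hi h1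
    have hpos : (0 : ℝ) < n i := by exact_mod_cast h1
    have hsq : √(n i : ℝ) ^ 2 = n i := Real.sq_sqrt hpos.le
    have hsp : 0 < √(n i : ℝ) := Real.sqrt_pos.2 hpos
    have hkey := norm_exp_sub_quadratic_le hi
    generalize hwd : (√(n i : ℝ))⁻¹ * y i = w at *
    have hyw : y i = √(n i : ℝ) * w := by rw [← hwd]; field_simp
    have e : (n i : ℂ) * (Complex.exp (w * Complex.I) - 1 - w * Complex.I) - -(y i : ℂ) ^ 2 / 2 =
        (n i : ℂ) * (Complex.exp (w * Complex.I) - 1 - w * Complex.I + (w : ℂ) ^ 2 / 2) := by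
      have : (y i : ℂ) ^ 2 = n i * (w : ℂ) ^ 2 := by
        rw [hyw]; push_cast; rw [mul_pow]; congr 1; exact_mod_cast hsq
      rw [neg_div, this]; ring
    rw [e, norm_mul, Complex.norm_natCast]
    calc _ ≤ (n i : ℝ) * |w| ^ 3 := by gcongr
      _ = _ := by
        rw [hyw, abs_mul, abs_of_pos hsp]
        nth_rewrite 1 [← hsq]
        field_simp
  have h1 : Tendsto (fun i => -(y i : ℂ) ^ 2 / 2) l (𝓝 (-(y₀ : ℂ) ^ 2 / 2)) := by
    have : Continuous fun y : ℝ => -(y : ℂ) ^ 2 / 2 := by fun_prop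
    exact (this.tendsto y₀).comp hy
  simpa using h0.add h1

/-- If `n → ∞` and `n g → t` along a filter then `(1 + g)^n → e^t`. -/
lemma tendsto_one_add_pow_exp {ι : Type*} {l : Filter ι} {n : ι → ℕ} {g : ι → ℂ} {t : ℂ}
    (hn : Tendsto n l atTop) (hg : Tendsto (fun i => (n i : ℂ) * g i) l (𝓝 t)) :
    Tendsto (fun i => (1 + g i) ^ n i) l (𝓝 (Complex.exp t)) := by
  have hninv : Tendsto (fun i => ((n i : ℂ))⁻¹) l (𝓝 0) :=
    (tendsto_inv_atTop_nhds_zero_nat (𝕜 := ℂ)).comp hn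
  have hne : ∀ᶠ i in l, (n i : ℂ) ≠ 0 := by
    filter_upwards [hn.eventually_ge_atTop 1] with i hi
    exact_mod_cast (by omega : n i ≠ 0)
  have hg0 : Tendsto g l (𝓝 0) := by
    have := hninv.mul hg
    rw [zero_mul] at this
    refine this.congr' ?_
    filter_upwards [hne] with i hi
    field_simp
  -- Since `log (1 + g) - g` is of order `‖g‖²`, the error after multiplication by `n` is at most
  -- `‖n g‖ ‖g‖`, a bounded factor times a vanishing one.
  have hlog : Tendsto (fun i => (n i : ℂ) * Complex.log (1 + g i)) l (𝓝 t) := by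
    have h0 : Tendsto (fun i => (n i : ℂ) * (Complex.log (1 + g i) - g i)) l (𝓝 0) := by
      have hb : Tendsto (fun i => ‖(n i : ℂ) * g i‖ * ‖g i‖) l (𝓝 0) := by
        simpa using hg.norm.mul hg0.norm
      refine squeeze_zero_norm' ?_ hb
      filter_upwards [hg0.norm.eventually_le_const (u := 1 / 2) (by norm_num)] with i hi
      have := Complex.norm_log_one_add_sub_self_le (z := g i) (by linarith)
      rw [norm_mul, norm_mul, mul_assoc]
      gcongr
      have h2 : (1 - ‖g i‖)⁻¹ ≤ 2 := by
        rw [inv_le_comm₀ (by linarith) (by norm_num)]; linarith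
      calc _ ≤ _ := this
        _ ≤ ‖g i‖ ^ 2 * 2 / 2 := by gcongr
        _ = _ := by ring
    simpa [mul_sub] using h0.add hg
  refine ((Complex.continuous_exp.tendsto t).comp hlog).congr' ?_
  filter_upwards [hg0.norm.eventually_lt_const (u := 1) (by norm_num)] with i hi
  have : 1 + g i ≠ 0 := fun h => by
    rw [show g i = -1 by linear_combination h] at hi
    simp at hi
  rw [Function.comp, Complex.exp_nat_mul, Complex.exp_log this]

/-- The central limit theorem on the level of characteristic functions, locally uniformly in the
tilting parameter. -/
lemma tendsto_centeredCharFun_pow (F : PMF (Fin d → ℤ)) {θ₀ : EuclideanSpace ℝ (Fin d)}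
    (hθ : θ₀ ∈ interiorDom F) (t : Fin d → ℝ) {ι : Type*} {l : Filter ι}
    [l.IsCountablyGenerated] {n : ι → ℕ} {τ : ι → EuclideanSpace ℝ (Fin d)}
    (hn : Tendsto n l atTop) (hτ : Tendsto τ l (𝓝 θ₀)) :
    Tendsto (fun i => centeredCharFun F (τ i) ((√(n i))⁻¹ • t) ^ n i) l
      (𝓝 (Complex.exp (-(quad F θ₀ t : ℂ) / 2))) := by
  obtain ⟨M, hM, hdev⟩ := exists_dev_bound F hθ t
  have hdevlim : ∀ x, Tendsto (fun i => dev F (τ i) t x) l (𝓝 (dev F θ₀ t x)) := fun x =>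
    tendsto_finsetSum _ fun j _ =>
      tendsto_const_nhds.mul (tendsto_const_nhds.sub ((tendsto_mean F hθ j).comp hτ))
  -- Subtracting the linear term does not change the integral, because `dev` has mean zero, and it
  -- leaves integrands with a quadratic majorant. The integral is thus `n` times the characteristic
  -- function minus one.
  have hlim := tendsto_integral_tiltedLaw F hθ hτ
    (f := fun i x => (n i : ℂ) * (Complex.exp (((√(n i))⁻¹ * dev F (τ i) t x : ℝ) * Complex.I)
      - 1 - ((√(n i))⁻¹ * dev F (τ i) t x : ℝ) * Complex.I))
    (g := fun x => -(dev F θ₀ t x : ℂ) ^ 2 / 2) (3 * M ^ 2) 2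
    (by
      filter_upwards [hτ.eventually hdev, hn.eventually_ge_atTop 1] with i hi h1 x
      have hpos : (0 : ℝ) < n i := by exact_mod_cast h1
      rw [norm_mul, Complex.norm_natCast]
      calc _ ≤ (n i : ℝ) * (3 * ((√(n i))⁻¹ * dev F (τ i) t x) ^ 2) := by
            gcongr; exact norm_exp_sub_one_sub_le _
        _ = 3 * |dev F (τ i) t x| ^ 2 := by
            rw [mul_pow, inv_pow, Real.sq_sqrt hpos.le, sq_abs]; field_simp
        _ ≤ 3 * (M * (1 + l1 x)) ^ 2 := by gcongr; exact hi x
        _ = _ := by ring)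
    (fun x => tendsto_mul_exp_sub hn (hdevlim x))
  have hval : ∫ x, -(dev F θ₀ t x : ℂ) ^ 2 / 2 ∂tiltedLaw F θ₀ = -(quad F θ₀ t : ℂ) / 2 := by
    rw [quad_eq_integral F hθ, integral_div, integral_neg, ← integral_complex_ofReal]
    push_cast; rfl
  rw [hval] at hlim
  have := tendsto_one_add_pow_exp (g := fun i => centeredCharFun F (τ i) ((√(n i))⁻¹ • t) - 1)
    hn (hlim.congr' ?_)
  · simpa using this
  · filter_upwards [hτ.eventually ((isOpen_interiorDom F).mem_nhds hθ)] with i hi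
    have := isProbabilityMeasure_tiltedLaw F hi
    have hd := integral_dev F hi ((√(n i : ℝ))⁻¹ • t)
    have hd' := integrable_dev F hi ((√(n i : ℝ))⁻¹ • t)
    replace hd' := (hd'.congr (ae_of_all _ fun x => dev_smul F (τ i) _ t x)).ofReal (𝕜 := ℂ)
    simp only [dev_smul] at hd
    have he : Integrable (fun x => Complex.exp
        (((√(n i : ℝ))⁻¹ * dev F (τ i) t x : ℝ) * Complex.I)) (tiltedLaw F (τ i)) :=
      integrable_tiltedLaw F hi _ 1 0 fun x => by rw [Complex.norm_exp_ofReal_mul_I]; simp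
    have h0 : ∫ x, (((√(n i : ℝ))⁻¹ * dev F (τ i) t x : ℝ) : ℂ) ∂tiltedLaw F (τ i) = 0 := by
      rw [integral_complex_ofReal, hd, Complex.ofReal_zero]
    have h1 := integral_sub (he.sub (integrable_const 1)) (hd'.mul_const Complex.I)
    have h2 := integral_sub he (integrable_const 1)
    simp only [Pi.sub_apply, RCLike.ofReal_eq_complex_ofReal] at h1
    rw [integral_const_mul, h1, h2, integral_mul_const, h0, centeredCharFun]
    simp [dev_smul]

/-! ### Decay of the characteristic function -/

lemma norm_centeredCharFun_le_one (F : PMF (Fin d → ℤ)) {θ : EuclideanSpace ℝ (Fin d)}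
    (hθ : θ ∈ interiorDom F) (u : Fin d → ℝ) : ‖centeredCharFun F θ u‖ ≤ 1 := by
  have := isProbabilityMeasure_tiltedLaw F hθ
  refine (norm_integral_le_of_norm_le_const (C := 1) (ae_of_all _ fun x => ?_)).trans (by simp)
  rw [Complex.norm_exp_ofReal_mul_I]

/-- Each pair of atoms bounds the modulus of the characteristic function away from one. -/
lemma sin_sq_le_one_sub_sq (F : PMF (Fin d → ℤ)) {θ : EuclideanSpace ℝ (Fin d)}
    (hθ : θ ∈ interiorDom F) (u : Fin d → ℝ) (x y : Fin d → ℤ) :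
    2 * (tiltedLaw F θ).real {x} * (tiltedLaw F θ).real {y} *
      Real.sin ((∑ j, u j * ((x - y) j : ℝ)) / 2) ^ 2 ≤ 1 - ‖centeredCharFun F θ u‖ ^ 2 := by
  have := isProbabilityMeasure_tiltedLaw F hθ
  set μ := tiltedLaw F θ with hμ
  -- Symmetrization: the squared modulus is the characteristic function of the difference of two
  -- independent copies.
  have hprod : ((‖centeredCharFun F θ u‖ ^ 2 : ℝ) : ℂ) =
      ∫ z, Complex.exp ((dev F θ u z.1 - dev F θ u z.2 : ℝ) * Complex.I) ∂(μ.prod μ) := by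
    rw [Complex.ofReal_pow, ← Complex.mul_conj', centeredCharFun, ← integral_conj,
      ← integral_prod_mul]
    refine integral_congr_ae (ae_of_all _ fun z => ?_)
    simp only
    rw [← Complex.exp_conj, ← Complex.exp_add]
    simp; ring_nf
  have hcos : ‖centeredCharFun F θ u‖ ^ 2 =
      ∫ z, Real.cos (dev F θ u z.1 - dev F θ u z.2) ∂(μ.prod μ) := by
    have h := congrArg Complex.re hprod
    rw [Complex.ofReal_re] at h
    rw [h]
    have hi : Integrable (fun z : (Fin d → ℤ) × (Fin d → ℤ) =>
        Complex.exp ((dev F θ u z.1 - dev F θ u z.2 : ℝ) * Complex.I)) (μ.prod μ) :=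
      Integrable.of_bound (measurable_of_countable _).aestronglyMeasurable 1
        (ae_of_all _ fun z => by rw [Complex.norm_exp_ofReal_mul_I])
    have := integral_re hi
    simp only [RCLike.re_to_complex, Complex.exp_ofReal_mul_I_re] at this
    exact this.symm
  have hint : Integrable (fun z : (Fin d → ℤ) × (Fin d → ℤ) =>
      1 - Real.cos (dev F θ u z.1 - dev F θ u z.2)) (μ.prod μ) :=
    Integrable.of_bound (measurable_of_countable _).aestronglyMeasurable 2
      (ae_of_all _ fun z => by
        rw [Real.norm_eq_abs, abs_le]
        constructor <;> linarith [Real.cos_le_one (dev F θ u z.1 - dev F θ u z.2),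
          Real.neg_one_le_cos (dev F θ u z.1 - dev F θ u z.2)])
  have hintc : Integrable (fun z : (Fin d → ℤ) × (Fin d → ℤ) =>
      Real.cos (dev F θ u z.1 - dev F θ u z.2)) (μ.prod μ) := by
    refine ((integrable_const (1 : ℝ)).sub hint).congr (ae_of_all _ fun z => ?_)
    simp
  -- The integrand `1 - cos` is nonnegative, so only the atom `(x, y)` is kept; the half-angle
  -- formula turns it into `2 sin²`.
  have hle := setIntegral_le_integral (s := {(x, y)}) hint
    (ae_of_all _ fun z => sub_nonneg.2 (Real.cos_le_one _))
  rw [integral_sub (integrable_const _) hintc, ← hcos, integral_singleton] at hle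
  simp only [integral_const, probReal_univ, smul_eq_mul, mul_one] at hle
  refine le_trans (le_of_eq ?_) hle
  have e : dev F θ u x - dev F θ u y = ∑ j, u j * ((x - y) j : ℝ) := by
    rw [dev, dev, ← Finset.sum_sub_distrib]
    refine Finset.sum_congr rfl fun j _ => ?_
    simp; ring
  rw [e, ← Set.singleton_prod_singleton, measureReal_prod_prod, Real.sin_sq_eq_half_sub]
  ring_nf

lemma abs_sin_add_le (a b : ℝ) : |Real.sin (a + b)| ≤ |Real.sin a| + |Real.sin b| := by
  rw [Real.sin_add]
  refine (abs_add_le _ _).trans ?_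
  rw [abs_mul, abs_mul]
  have := Real.abs_cos_le_one a
  have := Real.abs_cos_le_one b
  nlinarith [abs_nonneg (Real.sin a), abs_nonneg (Real.sin b)]

/-- The vectors `z` admitting such a `C` form a subgroup, as `|sin|` is even and subadditive. It
contains all differences of support points, so by aperiodicity it is everything. -/
lemma exists_abs_sin_le (F : PMF (Fin d → ℤ)) (hF : Aperiodic F)
    {θ₀ : EuclideanSpace ℝ (Fin d)} (hθ : θ₀ ∈ interiorDom F) (z : Fin d → ℤ) :
    ∃ C : ℝ, 0 ≤ C ∧ ∀ᶠ θ in 𝓝 θ₀, ∀ u : Fin d → ℝ,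
      |Real.sin ((∑ j, u j * (z j : ℝ)) / 2)| ≤ C * √(1 - ‖centeredCharFun F θ u‖ ^ 2) := by
  have hz : z ∈ AddSubgroup.closure (F.support - F.support) := by rw [hF]; trivial
  induction hz using AddSubgroup.closure_induction with
  | mem z hz =>
    obtain ⟨x, hx, y, hy, rfl⟩ := Set.mem_sub.1 hz
    have hpx := tiltedLaw_singleton_pos F hθ hx
    have hpy := tiltedLaw_singleton_pos F hθ hy
    set p := (tiltedLaw F θ₀).real {x} * (tiltedLaw F θ₀).real {y} with hp
    have hp0 : 0 < p := mul_pos hpx hpy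
    have hlim := (tendsto_tiltedLaw_singleton F hθ x).mul (tendsto_tiltedLaw_singleton F hθ y)
    -- Near `θ₀` the product of the two atoms exceeds `p / 2`, and the factor 2 of
    -- `sin_sq_le_one_sub_sq` restores `p`.
    refine ⟨√(1 / p), Real.sqrt_nonneg _, ?_⟩
    filter_upwards [hlim.eventually_const_lt (show p / 2 < _ by rw [← hp]; linarith),
      (isOpen_interiorDom F).mem_nhds hθ] with θ h1 h2 u
    rw [← Real.sqrt_mul (by positivity)]
    refine Real.abs_le_sqrt ?_
    have := sin_sq_le_one_sub_sq F h2 u x y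
    rw [one_div, ← div_eq_inv_mul, le_div_iff₀ hp0]
    refine le_trans ?_ this
    nlinarith [sq_nonneg (Real.sin ((∑ j, u j * ((x - y) j : ℝ)) / 2))]
  | zero => exact ⟨0, le_rfl, by simp⟩
  | add a b _ _ ha hb =>
    obtain ⟨A, hA, ha⟩ := ha
    obtain ⟨B, hB, hb⟩ := hb
    refine ⟨A + B, by positivity, ?_⟩
    filter_upwards [ha, hb] with θ ha hb u
    have : (∑ j, u j * ((a + b) j : ℝ)) / 2 =
        (∑ j, u j * (a j : ℝ)) / 2 + (∑ j, u j * (b j : ℝ)) / 2 := by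
      rw [← add_div, ← Finset.sum_add_distrib]; simp [mul_add]
    rw [this, add_mul]
    exact (abs_sin_add_le _ _).trans (add_le_add (ha u) (hb u))
  | neg a _ ha =>
    obtain ⟨A, hA, ha⟩ := ha
    refine ⟨A, hA, ?_⟩
    filter_upwards [ha] with θ ha u
    have : (∑ j, u j * ((-a) j : ℝ)) / 2 = -((∑ j, u j * (a j : ℝ)) / 2) := by
      simp [neg_div]
    rw [this, Real.sin_neg, abs_neg]
    exact ha u

/-- Gaussian decay of the characteristic functions on `[-π, π]^d`, locally uniformly in the tilting
parameter. -/
lemma exists_norm_centeredCharFun_le (F : PMF (Fin d → ℤ)) (hF : Aperiodic F)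
    {θ₀ : EuclideanSpace ℝ (Fin d)} (hθ : θ₀ ∈ interiorDom F) :
    ∃ c : ℝ, 0 < c ∧ ∀ᶠ θ in 𝓝 θ₀, ∀ u : Fin d → ℝ, (∀ j, |u j| ≤ Real.pi) →
      ‖centeredCharFun F θ u‖ ≤ Real.exp (-c * ∑ j, u j ^ 2) := by
  -- For a basis vector the sine is `sin (u j / 2)` with `|u j / 2| ≤ π / 2`, where Jordan's
  -- inequality bounds `|u j|` by a multiple of it.
  choose C hC hsin using fun j : Fin d => exists_abs_sin_le F hF hθ (Pi.single j 1)
  set B : ℝ := 1 + ∑ j, (Real.pi * C j) ^ 2 with hB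
  have hBpos : 0 < B := by positivity
  refine ⟨1 / (2 * B), by positivity, ?_⟩
  filter_upwards [eventually_all.2 hsin, (isOpen_interiorDom F).mem_nhds hθ] with θ hs hmem u hu
  have h1 := norm_centeredCharFun_le_one F hmem u
  set r := ‖centeredCharFun F θ u‖ with hr
  have hr0 : 0 ≤ r := norm_nonneg _
  have hnn : 0 ≤ 1 - r ^ 2 := by nlinarith
  have hj : ∀ j, u j ^ 2 ≤ (Real.pi * C j) ^ 2 * (1 - r ^ 2) := fun j => by
    have e : (∑ i, u i * ((Pi.single j 1 : Fin d → ℤ) i : ℝ)) = u j := by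
      rw [Finset.sum_eq_single j] <;> simp +contextual
    have h2 := hs j u
    rw [e] at h2
    have h3 := Real.mul_abs_le_abs_sin (x := u j / 2) (by
      rw [abs_div, abs_two]; linarith [hu j])
    have h4 : |u j| ≤ Real.pi * C j * √(1 - r ^ 2) := by
      have := h3.trans h2
      rw [abs_div, abs_two] at this
      have hpi := Real.pi_pos
      field_simp at this
      linarith
    rw [← sq_abs, ← Real.sq_sqrt hnn, ← mul_pow]
    have := hC j
    gcongr
  have hsum : ∑ j, u j ^ 2 ≤ B * (1 - r ^ 2) := by
    calc _ ≤ ∑ j, (Real.pi * C j) ^ 2 * (1 - r ^ 2) := Finset.sum_le_sum fun j _ => hj j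
      _ = (∑ j, (Real.pi * C j) ^ 2) * (1 - r ^ 2) := by rw [Finset.sum_mul]
      _ ≤ _ := by gcongr; linarith
  -- Uses `r ≤ (1 + r²) / 2`.
  have hfin : r ≤ 1 - 1 / (2 * B) * ∑ j, u j ^ 2 := by
    have : 1 / (2 * B) * ∑ j, u j ^ 2 ≤ (1 - r ^ 2) / 2 := by
      rw [one_div, inv_mul_le_iff₀ (by positivity)]; linarith
    nlinarith
  refine hfin.trans ?_
  have := Real.add_one_le_exp (-(1 / (2 * B)) * ∑ j, u j ^ 2)
  linarith

/-! ### Positive definiteness of the covariance matrix -/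

/-- Fix `θ` and let `n → ∞` in `‖χ(t / √n)‖ ^ n ≤ exp (-c |t|²)`, where `χ` is the centered
characteristic function. The left side tends to `exp (-quad / 2)`, so the same `c` bounds the
quadratic form from below. -/
lemma exists_le_quad (F : PMF (Fin d → ℤ)) (hF : Aperiodic F)
    {θ₀ : EuclideanSpace ℝ (Fin d)} (hθ : θ₀ ∈ interiorDom F) :
    ∃ c : ℝ, 0 < c ∧ (∀ᶠ θ in 𝓝 θ₀, ∀ t, c * ∑ j, t j ^ 2 ≤ quad F θ t / 2) ∧
      ∀ᶠ θ in 𝓝 θ₀, ∀ u : Fin d → ℝ, (∀ j, |u j| ≤ Real.pi) →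
      ‖centeredCharFun F θ u‖ ≤ Real.exp (-c * ∑ j, u j ^ 2) := by
  obtain ⟨c, hc, h⟩ := exists_norm_centeredCharFun_le F hF hθ
  refine ⟨c, hc, ?_, h⟩
  filter_upwards [h, (isOpen_interiorDom F).mem_nhds hθ] with θ h hmem t
  have hlim := (tendsto_centeredCharFun_pow F hmem t (n := id) (τ := fun _ => θ) tendsto_id
    tendsto_const_nhds).norm
  have hs : Tendsto (fun n : ℕ => (√(n : ℝ))⁻¹) atTop (𝓝 0) :=
    tendsto_inv_atTop_zero.comp (Real.tendsto_sqrt_atTop.comp tendsto_natCast_atTop_atTop)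
  have hsmall : ∀ᶠ n : ℕ in atTop, ∀ j, |((√(n : ℝ))⁻¹ • t) j| ≤ Real.pi := by
    rw [eventually_all]
    intro j
    have : Tendsto (fun n : ℕ => |((√(n : ℝ))⁻¹ • t) j|) atTop (𝓝 0) := by
      simpa using (hs.mul_const (t j)).abs
    exact this.eventually_le_const Real.pi_pos
  have hle : ‖Complex.exp (-(quad F θ t : ℂ) / 2)‖ ≤ Real.exp (-c * ∑ j, t j ^ 2) := by
    refine le_of_tendsto hlim ?_
    filter_upwards [hsmall, eventually_ge_atTop 1] with n hn h1
    have hpos : (0 : ℝ) < n := by exact_mod_cast h1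
    simp only [id, norm_pow]
    calc _ ≤ Real.exp (-c * ∑ j, ((√(n : ℝ))⁻¹ • t) j ^ 2) ^ n := by gcongr; exact h _ hn
      _ = _ := by
        rw [← Real.exp_nat_mul]
        congr 1
        simp only [Pi.smul_apply, smul_eq_mul, mul_pow, inv_pow, Real.sq_sqrt hpos.le]
        rw [← Finset.mul_sum]
        field_simp
  rw [Complex.norm_exp, Real.exp_le_exp] at hle
  have e : (-(quad F θ t : ℂ) / 2).re = -(quad F θ t) / 2 := by
    rw [← Complex.ofReal_neg, show (2 : ℂ) = ((2 : ℝ) : ℂ) by norm_num, ← Complex.ofReal_div,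
      Complex.ofReal_re]
  rw [e] at hle
  linarith

lemma posDef_covMatrix (F : PMF (Fin d → ℤ)) (hF : Aperiodic F)
    {θ : EuclideanSpace ℝ (Fin d)} (hθ : θ ∈ interiorDom F) : (covMatrix F θ).PosDef := by
  obtain ⟨c, hc, h, -⟩ := exists_le_quad F hF hθ
  refine Matrix.PosDef.of_dotProduct_mulVec_pos ?_ fun t ht => ?_
  · ext i j
    simp [covMatrix, covariance_comm]
  · have h1 := h.self_of_nhds t
    obtain ⟨j, hj : t j ≠ 0⟩ := Function.ne_iff.1 ht
    have h2 : 0 < ∑ j, t j ^ 2 :=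
      Finset.sum_pos' (fun _ _ => sq_nonneg _) ⟨j, Finset.mem_univ j, by positivity⟩
    have h3 : 0 < quad F θ t := by
      have := mul_pos hc h2
      linarith
    simpa [quad] using h3

/-! ### The Gaussian integral -/

lemma integral_comp_mulVec (A : Matrix (Fin d) (Fin d) ℝ) (hA : 0 < A.det)
    (f : (Fin d → ℝ) → ℂ) : (A.det : ℂ) * ∫ t, f (A.mulVec t) = ∫ t, f t := by
  have hu : IsUnit A.det := isUnit_iff_ne_zero.2 hA.ne'
  have hm : MeasurableEmbedding (Matrix.toLin' A) :=
    (A.toLinearEquiv'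
      (A.invertibleOfIsUnitDet hu)).toContinuousLinearEquiv.toHomeomorph.measurableEmbedding
  have h := hm.integral_map (μ := volume) f
  rw [Real.map_matrix_volume_pi_eq_smul_volume_pi hA.ne', integral_smul_measure] at h
  simp only [Matrix.toLin'_apply] at h
  rw [← h, abs_of_pos (inv_pos.2 hA), ENNReal.toReal_ofReal (inv_pos.2 hA).le, Complex.real_smul,
    ← mul_assoc, ← Complex.ofReal_mul, mul_inv_cancel₀ hA.ne', Complex.ofReal_one, one_mul]

/-- With `S = √A` and `y = S z`, the substitution `v = S t` gives the form `|v|²` and the phase `⟨z,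
v⟩`, as `S` is symmetric. The Jacobian `det S = (det A)^{1/2}` absorbs the prefactor, leaving a
standard Gaussian integral. -/
lemma integral_gaussian_charFun (A : Matrix (Fin d) (Fin d) ℝ) (hA : A.PosDef)
    (y : EuclideanSpace ℝ (Fin d)) :
    ((A.det ^ (1 / 2 : ℝ) : ℝ) : ℂ) * ∫ t : Fin d → ℝ,
      Complex.exp (-((t ⬝ᵥ A.mulVec t : ℝ) : ℂ) / 2) *
        Complex.exp (-((∑ j, t j * y j : ℝ) : ℂ) * Complex.I) =
      (((2 * Real.pi) ^ ((d : ℝ) / 2) *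
        Real.exp (-‖Matrix.toEuclideanLin (CFC.sqrt A)⁻¹ y‖ ^ 2 / 2) : ℝ) : ℂ) := by
  set S := CFC.sqrt A with hS
  have hSS : S * S = A := CFC.sqrt_mul_sqrt_self A hA.posSemidef.nonneg
  have hSpsd : S.PosSemidef := Matrix.nonneg_iff_posSemidef.1 (CFC.sqrt_nonneg A)
  have hSt : S.transpose = S := by simpa using hSpsd.isHermitian.eq
  have hdet2 : S.det * S.det = A.det := by rw [← Matrix.det_mul, hSS]
  have hSdet : 0 < S.det := by
    have h0 := hSpsd.det_nonneg
    have h1 := hA.det_pos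
    rcases h0.eq_or_lt with h | h
    · rw [← hdet2, ← h] at h1; simp at h1
    · exact h
  have hroot : A.det ^ (1 / 2 : ℝ) = S.det := by
    rw [← Real.sqrt_eq_rpow, ← hdet2, Real.sqrt_mul_self hSdet.le]
  set z := Matrix.toEuclideanLin S⁻¹ y with hz
  have hSz : S.mulVec z.ofLp = y.ofLp := by
    have : z.ofLp = S⁻¹.mulVec y.ofLp := rfl
    rw [this, Matrix.mulVec_mulVec, Matrix.mul_nonsing_inv _ (isUnit_iff_ne_zero.2 hSdet.ne'),
      Matrix.one_mulVec]
  have hq : ∀ t : Fin d → ℝ, t ⬝ᵥ A.mulVec t = ∑ j, (S.mulVec t) j ^ 2 := fun t => by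
    rw [← hSS, ← Matrix.mulVec_mulVec, Matrix.dotProduct_mulVec, ← Matrix.mulVec_transpose, hSt]
    simp [dotProduct, sq]
  have hl : ∀ t : Fin d → ℝ, ∑ j, t j * y j = ∑ j, z j * (S.mulVec t) j := fun t => by
    change t ⬝ᵥ y.ofLp = z.ofLp ⬝ᵥ S.mulVec t
    rw [← hSz, Matrix.dotProduct_mulVec, ← Matrix.mulVec_transpose, hSt, dotProduct_comm]
  simp_rw [hq, hl]
  rw [hroot]
  have hcov := integral_comp_mulVec S hSdet (fun t => Complex.exp (-((∑ j, t j ^ 2 : ℝ) : ℂ) / 2) *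
    Complex.exp (-((∑ j, z j * t j : ℝ) : ℂ) * Complex.I))
  rw [hcov]
  have hg := GaussianFourier.integral_cexp_neg_mul_sum_add (ι := Fin d) (b := 1 / 2) (by norm_num)
    (fun j => -(z j : ℂ) * Complex.I)
  have e : ∀ t : Fin d → ℝ, Complex.exp (-((∑ j, t j ^ 2 : ℝ) : ℂ) / 2) *
      Complex.exp (-((∑ j, z j * t j : ℝ) : ℂ) * Complex.I) =
      Complex.exp (-(1 / 2) * ∑ j, (t j : ℂ) ^ 2 + ∑ j, -(z j : ℂ) * Complex.I * t j) := fun t => by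
    rw [← Complex.exp_add]
    congr 1
    push_cast
    have h1 : ∑ j, -(z j : ℂ) * Complex.I * t j = -(∑ j, (z j : ℂ) * t j) * Complex.I := by
      rw [neg_mul, Finset.sum_mul, ← Finset.sum_neg_distrib]
      exact Finset.sum_congr rfl fun j _ => by ring
    rw [h1]
    ring
  simp_rw [e]
  rw [hg]
  have hn : ‖z‖ ^ 2 = ∑ j, z j ^ 2 := by
    rw [EuclideanSpace.norm_sq_eq]; simp
  rw [Complex.ofReal_mul, Complex.ofReal_exp, Complex.ofReal_cpow (by positivity), hn]
  congr 2
  · push_cast; ring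
  · push_cast; simp
  · simp only [mul_pow, Complex.I_sq, neg_sq]
    push_cast
    rw [← Finset.sum_mul]; ring

/-! ### Fourier inversion -/

/-- The cube `[-π, π]^d`. -/
def cube (d : ℕ) : Set (Fin d → ℝ) := Set.univ.pi fun _ => Set.Icc (-Real.pi) Real.pi

lemma measurableSet_cube : MeasurableSet (cube d) :=
  MeasurableSet.univ_pi fun _ => measurableSet_Icc

lemma isCompact_cube : IsCompact (cube d) := isCompact_univ_pi fun _ => isCompact_Icc

instance isFiniteMeasure_restrict_cube : IsFiniteMeasure (volume.restrict (cube d)) :=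
  ⟨by simpa using isCompact_cube.measure_lt_top⟩

lemma abs_le_pi_of_mem_cube {u : Fin d → ℝ} (hu : u ∈ cube d) (j : Fin d) : |u j| ≤ Real.pi :=
  abs_le.2 (hu j trivial)

lemma integral_exp_int (k : ℤ) :
    ∫ t in Set.Icc (-Real.pi) Real.pi, Complex.exp ((t * k : ℝ) * Complex.I) =
      if k = 0 then (2 * Real.pi : ℂ) else 0 := by
  rw [integral_Icc_eq_integral_Ioc, ← intervalIntegral.integral_of_le (by linarith [Real.pi_pos])]
  split_ifs with hk
  · simp [hk]; ring
  · have hc : (k * Complex.I : ℂ) ≠ 0 := by simp [hk]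
    have := integral_exp_mul_complex (a := -Real.pi) (b := Real.pi) hc
    have e : ∀ t : ℝ, Complex.exp ((t * k : ℝ) * Complex.I) =
        Complex.exp (k * Complex.I * t) := fun t => by
      congr 1; push_cast; ring
    simp_rw [e]
    rw [this, div_eq_zero_iff, sub_eq_zero, Complex.exp_eq_exp_iff_exists_int]
    exact Or.inl ⟨k, by push_cast; ring⟩

lemma integral_cube_exp (k : Fin d → ℤ) :
    ∫ u in cube d, Complex.exp ((∑ j, u j * (k j : ℝ) : ℝ) * Complex.I) =
      if k = 0 then (2 * Real.pi : ℂ) ^ d else 0 := by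
  have e : ∀ u : Fin d → ℝ, Complex.exp ((∑ j, u j * (k j : ℝ) : ℝ) * Complex.I) =
      ∏ j, Complex.exp ((u j * k j : ℝ) * Complex.I) := fun u => by
    rw [← Complex.exp_sum, Complex.ofReal_sum, Finset.sum_mul]
  simp_rw [e]
  rw [cube, volume_pi, Measure.restrict_pi_pi,
    integral_fintype_prod_eq_prod (f := fun j (t : ℝ) => Complex.exp ((t * k j : ℝ) * Complex.I))]
  simp_rw [integral_exp_int]
  split_ifs with hk
  · simp [hk]
  · obtain ⟨j, hj⟩ := Function.ne_iff.1 hk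
    exact Finset.prod_eq_zero (Finset.mem_univ j) (by simpa using hj)

lemma integral_exp_sum_eq (F : PMF (Fin d → ℤ)) {θ : EuclideanSpace ℝ (Fin d)}
    {Ω : Type*} [MeasurableSpace Ω] {P : Measure Ω} {X : ℕ → Ω → (Fin d → ℤ)}
    (hindep : iIndepFun X P) (hlaw : ∀ l, HasLaw (X l) (tiltedLaw F θ) P) (n : ℕ)
    (u : Fin d → ℝ) :
    ∫ ω, Complex.exp ((∑ j, u j * (((∑ l ∈ Finset.range n, X l ω) j : ℤ) - n * mean F θ j) : ℝ)
      * Complex.I) ∂P = centeredCharFun F θ u ^ n := by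
  -- The product formula for expectations needs a finite index type, hence the restriction to `Fin
  -- n`.
  have h := (hindep.precomp Fin.val_injective (g := fun i : Fin n => (i : ℕ))).integral_fun_prod_comp
    (f := fun _ x => Complex.exp (dev F θ u x * Complex.I))
    (fun i => (hlaw i).aemeasurable)
    (fun i => Measurable.aestronglyMeasurable (by fun_prop))
  have h1 : ∀ i : Fin n, ∫ ω, Complex.exp (dev F θ u (X i ω) * Complex.I) ∂P =
      centeredCharFun F θ u := fun i => by
    rw [centeredCharFun, ← (hlaw i).integral_comp
      (f := fun x => Complex.exp (dev F θ u x * Complex.I))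
      (Measurable.aestronglyMeasurable (by fun_prop))]
    rfl
  simp only [h1, Finset.prod_const, Finset.card_univ, Fintype.card_fin] at h
  rw [← h]
  refine integral_congr_ae (ae_of_all _ fun ω => ?_)
  simp only
  rw [← Complex.exp_sum, ← Finset.sum_mul, ← Complex.ofReal_sum,
    Fin.sum_univ_eq_sum_range (fun l => dev F θ u (X l ω)) n]
  congr 3
  simp only [dev]
  rw [Finset.sum_comm]
  refine Finset.sum_congr rfl fun j _ => ?_
  rw [← Finset.mul_sum, Finset.sum_sub_distrib]
  simp

/-- The means cancel, so the integrand is the expectation of `exp (i⟨u, S_n - s⟩)`. After Fubini,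
orthogonality of characters on the cube leaves only `S_n = s`. -/
lemma fourier_inversion (F : PMF (Fin d → ℤ)) {θ : EuclideanSpace ℝ (Fin d)}
    {Ω : Type*} [MeasurableSpace Ω] {P : Measure Ω} [IsProbabilityMeasure P]
    {X : ℕ → Ω → (Fin d → ℤ)}
    (hindep : iIndepFun X P) (hlaw : ∀ l, HasLaw (X l) (tiltedLaw F θ) P) (n : ℕ)
    (s : Fin d → ℤ) :
    (2 * Real.pi : ℂ) ^ d * (P.real {ω | ∑ l ∈ Finset.range n, X l ω = s} : ℂ) =
      ∫ u in cube d, centeredCharFun F θ u ^ n *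
        Complex.exp (-((∑ j, u j * (s j - n * mean F θ j) : ℝ) : ℂ) * Complex.I) := by
  have hm : AEMeasurable (fun ω => ∑ l ∈ Finset.range n, X l ω) P :=
    Finset.aemeasurable_fun_sum _ fun l _ => (hlaw l).aemeasurable
  set ν := P.map (fun ω => ∑ l ∈ Finset.range n, X l ω) with hν
  have : IsProbabilityMeasure ν := Measure.isProbabilityMeasure_map hm
  have h1 : ∀ u : Fin d → ℝ, centeredCharFun F θ u ^ n *
      Complex.exp (-((∑ j, u j * (s j - n * mean F θ j) : ℝ) : ℂ) * Complex.I) =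
      ∫ k, Complex.exp ((∑ j, u j * ((k - s) j : ℝ) : ℝ) * Complex.I) ∂ν := fun u => by
    rw [hν, integral_map hm (Measurable.aestronglyMeasurable (by fun_prop)),
      ← integral_exp_sum_eq F hindep hlaw n u, ← integral_mul_const]
    refine integral_congr_ae (ae_of_all _ fun ω => ?_)
    simp only
    rw [← Complex.exp_add, ← add_mul, ← Complex.ofReal_neg, ← Complex.ofReal_add,
      ← Finset.sum_neg_distrib, ← Finset.sum_add_distrib]
    congr 3
    refine Finset.sum_congr rfl fun j _ => ?_
    rw [Pi.sub_apply, Int.cast_sub]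
    ring
  simp_rw [h1]
  rw [integral_integral_swap]
  · simp_rw [integral_cube_exp, sub_eq_zero]
    have h2 : ∀ k : Fin d → ℤ, (if k = s then (2 * Real.pi : ℂ) ^ d else 0) =
        Set.indicator {s} (fun _ => (2 * Real.pi : ℂ) ^ d) k := fun k => by
      by_cases h : k = s <;> simp [h]
    simp_rw [h2]
    rw [integral_indicator_const _ (measurableSet_singleton s), hν,
      map_measureReal_apply_of_aemeasurable hm (measurableSet_singleton s), Complex.real_smul,
      mul_comm]
    rfl
  · refine Integrable.of_bound (C := 1) (Measurable.aestronglyMeasurable ?_)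
      (ae_of_all _ fun z => by simp only [Function.uncurry, Complex.norm_exp_ofReal_mul_I, le_refl])
    refine measurable_from_prod_countable_left fun k => ?_
    simp only [Function.uncurry]
    fun_prop

/-! ### The error term -/

/-- The rescaled `n`-th power of the centered characteristic function, cut off outside the
cube. -/
noncomputable def cutoffPow (F : PMF (Fin d → ℤ)) (n : ℕ) (θ : EuclideanSpace ℝ (Fin d))
    (t : Fin d → ℝ) : ℂ :=
  (cube d).indicator (fun u => centeredCharFun F θ u ^ n) ((√(n : ℝ))⁻¹ • t)

/-- The `L¹` distance between the rescaled characteristic function and its Gaussian limit. -/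
noncomputable def charFunError (F : PMF (Fin d → ℤ)) (n : ℕ) (θ : EuclideanSpace ℝ (Fin d)) : ℝ :=
  ∫ t, ‖cutoffPow F n θ t - Complex.exp (-(quad F θ t : ℂ) / 2)‖

lemma continuous_centeredCharFun (F : PMF (Fin d → ℤ)) {θ : EuclideanSpace ℝ (Fin d)}
    (hθ : θ ∈ interiorDom F) : Continuous (centeredCharFun F θ) := by
  have := isProbabilityMeasure_tiltedLaw F hθ
  refine continuous_of_dominated (bound := fun _ => 1)
    (fun u => Measurable.aestronglyMeasurable (by fun_prop))
    (fun u => ae_of_all _ fun x => by rw [Complex.norm_exp_ofReal_mul_I]) (integrable_const _)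
    (ae_of_all _ fun x => ?_)
  unfold dev
  fun_prop

lemma measurable_cutoffPow (F : PMF (Fin d → ℤ)) (n : ℕ) {θ : EuclideanSpace ℝ (Fin d)}
    (hθ : θ ∈ interiorDom F) : Measurable (cutoffPow F n θ) :=
  (((continuous_centeredCharFun F hθ).pow n).measurable.indicator measurableSet_cube).comp
    (measurable_const_smul _)

/-- The Gaussian bound is invariant under the rescaling: `exp (-c |t|² / n) ^ n = exp (-c |t|²)`. -/
lemma norm_cutoffPow_le (F : PMF (Fin d → ℤ)) {n : ℕ} (hn : 1 ≤ n)
    {θ : EuclideanSpace ℝ (Fin d)} {c : ℝ}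
    (h : ∀ u : Fin d → ℝ, (∀ j, |u j| ≤ Real.pi) →
      ‖centeredCharFun F θ u‖ ≤ Real.exp (-c * ∑ j, u j ^ 2)) (t : Fin d → ℝ) :
    ‖cutoffPow F n θ t‖ ≤ Real.exp (-c * ∑ j, t j ^ 2) := by
  have hpos : (0 : ℝ) < n := by exact_mod_cast hn
  by_cases ht : (√(n : ℝ))⁻¹ • t ∈ cube d
  · rw [cutoffPow, Set.indicator_of_mem ht, norm_pow]
    calc _ ≤ Real.exp (-c * ∑ j, ((√(n : ℝ))⁻¹ • t) j ^ 2) ^ n := by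
          gcongr; exact h _ (abs_le_pi_of_mem_cube ht)
      _ = _ := by
        rw [← Real.exp_nat_mul]
        congr 1
        simp only [Pi.smul_apply, smul_eq_mul, mul_pow, inv_pow, Real.sq_sqrt hpos.le]
        rw [← Finset.mul_sum]
        field_simp
  · rw [cutoffPow, Set.indicator_of_notMem ht, norm_zero]
    positivity

lemma norm_exp_quad_le (F : PMF (Fin d → ℤ)) {θ : EuclideanSpace ℝ (Fin d)} {c : ℝ}
    {t : Fin d → ℝ} (h : c * ∑ j, t j ^ 2 ≤ quad F θ t / 2) :
    ‖Complex.exp (-(quad F θ t : ℂ) / 2)‖ ≤ Real.exp (-c * ∑ j, t j ^ 2) := by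
  have e : (-(quad F θ t : ℂ) / 2) = ((-(quad F θ t) / 2 : ℝ) : ℂ) := by push_cast; rfl
  rw [e, ← Complex.ofReal_exp, Complex.norm_real, Real.norm_of_nonneg (Real.exp_pos _).le,
    Real.exp_le_exp]
  linarith

lemma integrable_exp_neg_mul_sum_sq {c : ℝ} (hc : 0 < c) :
    Integrable (fun t : Fin d → ℝ => Real.exp (-c * ∑ j, t j ^ 2)) := by
  have := (GaussianFourier.integrable_cexp_neg_mul_sum_add (b := c) (ι := Fin d)
    (by simpa using hc) 0).norm
  refine this.congr (ae_of_all _ fun t => ?_)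
  simp only [Pi.zero_apply, zero_mul, Finset.sum_const_zero, add_zero]
  rw [← Real.norm_of_nonneg (Real.exp_pos (-c * ∑ j, t j ^ 2)).le, ← Complex.norm_real]
  push_cast
  rfl

lemma integrable_cutoffPow (F : PMF (Fin d → ℤ)) (hF : Aperiodic F) {n : ℕ} (hn : 1 ≤ n)
    {θ : EuclideanSpace ℝ (Fin d)} (hθ : θ ∈ interiorDom F) : Integrable (cutoffPow F n θ) := by
  obtain ⟨c, hc, -, h⟩ := exists_le_quad F hF hθ
  exact (integrable_exp_neg_mul_sum_sq hc).mono'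
    (measurable_cutoffPow F n hθ).aestronglyMeasurable
    (ae_of_all _ (norm_cutoffPow_le F hn h.self_of_nhds))

lemma continuous_exp_quad (F : PMF (Fin d → ℤ)) (θ : EuclideanSpace ℝ (Fin d)) :
    Continuous fun t => Complex.exp (-(quad F θ t : ℂ) / 2) := by
  have := continuous_quad_vec F θ
  fun_prop

lemma integrable_exp_quad (F : PMF (Fin d → ℤ)) (hF : Aperiodic F)
    {θ : EuclideanSpace ℝ (Fin d)} (hθ : θ ∈ interiorDom F) :
    Integrable fun t => Complex.exp (-(quad F θ t : ℂ) / 2) := by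
  obtain ⟨c, hc, h, -⟩ := exists_le_quad F hF hθ
  exact (integrable_exp_neg_mul_sum_sq hc).mono'
    (continuous_exp_quad F θ).aestronglyMeasurable
    (ae_of_all _ fun t => norm_exp_quad_le F (h.self_of_nhds t))

lemma tendsto_charFunError (F : PMF (Fin d → ℤ)) (hF : Aperiodic F)
    {θ₀ : EuclideanSpace ℝ (Fin d)} (hθ : θ₀ ∈ interiorDom F) :
    Tendsto (fun p : ℕ × EuclideanSpace ℝ (Fin d) => charFunError F p.1 p.2)
      (atTop ×ˢ 𝓝 θ₀) (𝓝 0) := by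
  obtain ⟨c, hc, hq, hchar⟩ := exists_le_quad F hF hθ
  have hn : Tendsto (Prod.fst : ℕ × EuclideanSpace ℝ (Fin d) → ℕ) (atTop ×ˢ 𝓝 θ₀) atTop :=
    tendsto_fst
  have hτ : Tendsto (Prod.snd : ℕ × EuclideanSpace ℝ (Fin d) → _) (atTop ×ˢ 𝓝 θ₀) (𝓝 θ₀) :=
    tendsto_snd
  rw [show (0 : ℝ) = ∫ _ : Fin d → ℝ, (0 : ℝ) by simp]
  refine tendsto_integral_filter_of_dominated_convergence
    (fun t => 2 * Real.exp (-c * ∑ j, t j ^ 2)) ?_ ?_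
    ((integrable_exp_neg_mul_sum_sq hc).const_mul 2) (ae_of_all _ fun t => ?_)
  · filter_upwards [hτ.eventually ((isOpen_interiorDom F).mem_nhds hθ)] with p hp
    exact ((measurable_cutoffPow F p.1 hp).sub
      (continuous_exp_quad F p.2).measurable).norm.aestronglyMeasurable
  · filter_upwards [hτ.eventually hq, hτ.eventually hchar, hn.eventually_ge_atTop 1]
      with p h1 h2 h3
    refine ae_of_all _ fun t => ?_
    rw [norm_norm, two_mul]
    exact (norm_sub_le _ _).trans
      (add_le_add (norm_cutoffPow_le F h3 h2 t) (norm_exp_quad_le F (h1 t)))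
  · have h1 := tendsto_centeredCharFun_pow F hθ t hn hτ
    have h2 : Tendsto (fun p : ℕ × EuclideanSpace ℝ (Fin d) =>
        Complex.exp (-(quad F p.2 t : ℂ) / 2)) (atTop ×ˢ 𝓝 θ₀)
        (𝓝 (Complex.exp (-(quad F θ₀ t : ℂ) / 2))) := by
      have hcont : Continuous fun q : ℝ => Complex.exp (-(q : ℂ) / 2) := by fun_prop
      exact (hcont.tendsto _).comp ((tendsto_quad F hθ t).comp hτ)
    have h3 := (h1.sub h2).norm
    rw [sub_self, norm_zero] at h3
    have hs : Tendsto (fun n : ℕ => (√(n : ℝ))⁻¹) atTop (𝓝 0) :=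
      tendsto_inv_atTop_zero.comp (Real.tendsto_sqrt_atTop.comp tendsto_natCast_atTop_atTop)
    -- For fixed `t` the cutoff is eventually inactive.
    have hsmall : ∀ᶠ n : ℕ in atTop, (√(n : ℝ))⁻¹ • t ∈ cube d := by
      have : ∀ᶠ n : ℕ in atTop, ∀ j, |((√(n : ℝ))⁻¹ • t) j| ≤ Real.pi := by
        rw [eventually_all]
        intro j
        have : Tendsto (fun n : ℕ => |((√(n : ℝ))⁻¹ • t) j|) atTop (𝓝 0) := by
          simpa using (hs.mul_const (t j)).abs
        exact this.eventually_le_const Real.pi_pos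
      filter_upwards [this] with n hn j _ using abs_le.1 (hn j)
    refine h3.congr' ?_
    filter_upwards [hn.eventually hsmall] with p hp
    rw [cutoffPow, Set.indicator_of_mem hp]

/-- The error in the local limit theorem is bounded uniformly in the endpoint. -/
lemma abs_sub_le_charFunError (F : PMF (Fin d → ℤ)) (hF : Aperiodic F)
    {θ : EuclideanSpace ℝ (Fin d)} (hθ : θ ∈ interiorDom F)
    {Ω : Type*} [MeasurableSpace Ω] {P : Measure Ω} {X : ℕ → Ω → (Fin d → ℤ)}
    (hindep : iIndepFun X P) (hlaw : ∀ l, HasLaw (X l) (tiltedLaw F θ) P) {n : ℕ} (hn : 1 ≤ n)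
    (s : Fin d → ℤ) :
    |(n : ℝ) ^ ((d : ℝ) / 2) * (covMatrix F θ).det ^ (1 / 2 : ℝ) *
        P.real {ω | ∑ l ∈ Finset.range n, X l ω = s} -
      (2 * Real.pi) ^ (-(d : ℝ) / 2) * Real.exp (-‖zVec F n θ s‖ ^ 2 / 2)| ≤
    (covMatrix F θ).det ^ (1 / 2 : ℝ) * charFunError F n θ := by
  have hP : IsProbabilityMeasure P := hindep.isProbabilityMeasure
  have hpos : (0 : ℝ) < n := by exact_mod_cast hn
  have hsq : 0 < √(n : ℝ) := Real.sqrt_pos.2 hpos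
  have hpd := posDef_covMatrix F hF hθ
  set D := (covMatrix F θ).det ^ (1 / 2 : ℝ) with hD
  have hD0 : 0 ≤ D := Real.rpow_nonneg hpd.det_pos.le _
  set p := P.real {ω | ∑ l ∈ Finset.range n, X l ω = s} with hp
  set y : EuclideanSpace ℝ (Fin d) :=
    (√(n : ℝ))⁻¹ • (toEuclid s - (n : ℝ) • mean F θ) with hy
  have hyj : ∀ j, y j = (√(n : ℝ))⁻¹ * (s j - n * mean F θ j) := fun j => by
    simp [hy, toEuclid]
  have hz : zVec F n θ s = Matrix.toEuclideanLin (CFC.sqrt (covMatrix F θ))⁻¹ y := by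
    rw [zVec, hy, map_smul, Real.rpow_neg hpos.le, ← Real.sqrt_eq_rpow]
  let ph : (Fin d → ℝ) → ℂ := fun t =>
    Complex.exp (-((∑ j, t j * y j : ℝ) : ℂ) * Complex.I)
  have hph : ∀ t, ‖ph t‖ = 1 := fun t => by
    simp only [ph]
    rw [← Complex.ofReal_neg, Complex.norm_exp_ofReal_mul_I]
  have hphc : Continuous ph := by
    simp only [ph]; fun_prop
  have hnd : (n : ℝ) ^ ((d : ℝ) / 2) = √(n : ℝ) ^ d := by
    rw [Real.sqrt_eq_rpow, ← Real.rpow_natCast, ← Real.rpow_mul hpos.le]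
    congr 1; ring
  -- Inversion after `u = t / √n`; the Jacobian supplies `n^{d/2}`.
  have hinv : (2 * Real.pi : ℂ) ^ d * (((n : ℝ) ^ ((d : ℝ) / 2) * p : ℝ) : ℂ) =
      ∫ t, cutoffPow F n θ t * ph t := by
    have h1 := fourier_inversion F hindep hlaw n s
    rw [← integral_indicator measurableSet_cube] at h1
    have h2 := Measure.integral_comp_inv_smul (volume : Measure (Fin d → ℝ))
      ((cube d).indicator fun u => centeredCharFun F θ u ^ n *
        Complex.exp (-((∑ j, u j * (s j - n * mean F θ j) : ℝ) : ℂ) * Complex.I)) (√(n : ℝ))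
    rw [← h1, Module.finrank_fin_fun, abs_of_pos (by positivity), Complex.real_smul] at h2
    rw [hnd, Complex.ofReal_mul, mul_left_comm, ← h2]
    refine integral_congr_ae (ae_of_all _ fun t => ?_)
    simp only
    rw [cutoffPow]
    by_cases ht : (√(n : ℝ))⁻¹ • t ∈ cube d
    · rw [Set.indicator_of_mem ht, Set.indicator_of_mem ht]
      simp only [ph]
      congr 5
      refine Finset.sum_congr rfl fun j _ => ?_
      rw [hyj, Pi.smul_apply, smul_eq_mul]
      ring
    · rw [Set.indicator_of_notMem ht, Set.indicator_of_notMem ht, zero_mul]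
  have hgauss := integral_gaussian_charFun (covMatrix F θ) hpd y
  rw [← hz] at hgauss
  set g := Real.exp (-‖zVec F n θ s‖ ^ 2 / 2) with hg
  have h2pi : (0 : ℝ) < 2 * Real.pi := by positivity
  have hcpow : (2 * Real.pi) ^ d * (2 * Real.pi) ^ (-(d : ℝ) / 2) =
      (2 * Real.pi) ^ ((d : ℝ) / 2) := by
    rw [← Real.rpow_natCast, ← Real.rpow_add h2pi]
    congr 1; ring
  have hint1 : Integrable fun t => cutoffPow F n θ t * ph t :=
    (integrable_cutoffPow F hF hn hθ).mul_bdd (c := 1) hphc.aestronglyMeasurable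
      (ae_of_all _ fun t => (hph t).le)
  have hint2 : Integrable fun t => Complex.exp (-(quad F θ t : ℂ) / 2) * ph t :=
    (integrable_exp_quad F hF hθ).mul_bdd (c := 1) hphc.aestronglyMeasurable
      (ae_of_all _ fun t => (hph t).le)
  -- Both terms carry the same phase `ph`, so their difference is a single integral.
  have hdiff : ((2 * Real.pi) ^ d * ((n : ℝ) ^ ((d : ℝ) / 2) * D * p -
      (2 * Real.pi) ^ (-(d : ℝ) / 2) * g) : ℝ) =
      (D : ℂ) * ∫ t, (cutoffPow F n θ t - Complex.exp (-(quad F θ t : ℂ) / 2)) * ph t := by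
    simp_rw [sub_mul]
    rw [integral_sub hint1 hint2, mul_sub (D : ℂ), ← hinv]
    have : (D : ℂ) * ∫ t, Complex.exp (-(quad F θ t : ℂ) / 2) * ph t =
      (((2 * Real.pi) ^ ((d : ℝ) / 2) * g : ℝ) : ℂ) := hgauss
    rw [this, ← hcpow]
    push_cast
    ring
  have hnorm := congrArg norm hdiff
  rw [Complex.norm_real, norm_mul, norm_mul, Complex.norm_real, Real.norm_of_nonneg hD0,
    Real.norm_eq_abs, Real.norm_eq_abs, abs_of_pos (by positivity)] at hnorm
  have hbd : ‖∫ t, (cutoffPow F n θ t - Complex.exp (-(quad F θ t : ℂ) / 2)) * ph t‖ ≤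
      charFunError F n θ := by
    refine (norm_integral_le_integral_norm _).trans (le_of_eq ?_)
    simp_rw [norm_mul, hph, mul_one]
    rfl
  -- The factor `(2π)^d` is at least one and is simply discarded.
  have h1 : (1 : ℝ) ≤ (2 * Real.pi) ^ d := one_le_pow₀ (by linarith [Real.pi_gt_three])
  calc _ ≤ (2 * Real.pi) ^ d * _ := le_mul_of_one_le_left (abs_nonneg _) h1
    _ = _ := hnorm
    _ ≤ _ := by gcongr

lemma tendsto_error_bound (F : PMF (Fin d → ℤ)) (hF : Aperiodic F)
    {θ₀ : EuclideanSpace ℝ (Fin d)} (hθ : θ₀ ∈ interiorDom F) :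
    Tendsto (fun p : ℕ × EuclideanSpace ℝ (Fin d) =>
      (covMatrix F p.2).det ^ (1 / 2 : ℝ) * charFunError F p.1 p.2) (atTop ×ˢ 𝓝 θ₀) (𝓝 0) := by
  have hdet : Tendsto (fun θ => (covMatrix F θ).det ^ (1 / 2 : ℝ)) (𝓝 θ₀)
      (𝓝 ((covMatrix F θ₀).det ^ (1 / 2 : ℝ))) := by
    have hc : Continuous fun A : Matrix (Fin d) (Fin d) ℝ => A.det ^ (1 / 2 : ℝ) :=
      (Real.continuous_rpow_const (by norm_num)).comp continuous_id.matrix_det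
    exact (hc.tendsto _).comp (tendsto_covMatrix F hθ)
  simpa using (hdet.comp tendsto_snd).mul (tendsto_charFunError F hF hθ)

/-- Each point of `K` has a neighbourhood and a threshold for `n`; compactness yields a common
threshold. -/
lemma eventually_error_bound_le (F : PMF (Fin d → ℤ)) (hF : Aperiodic F)
    {K : Set (EuclideanSpace ℝ (Fin d))} (hK : IsCompact K) (hKI : K ⊆ interiorDom F)
    {δ : ℝ} (hδ : 0 < δ) :
    ∀ᶠ n : ℕ in atTop, ∀ θ ∈ K,
      (covMatrix F θ).det ^ (1 / 2 : ℝ) * charFunError F n θ ≤ δ := by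
  have hmem : {p : ℕ × EuclideanSpace ℝ (Fin d) |
      (covMatrix F p.2).det ^ (1 / 2 : ℝ) * charFunError F p.1 p.2 ≤ δ} ∈ atTop ×ˢ 𝓝ˢ K :=
    hK.mem_prod_nhdsSet_of_forall fun θ hθ =>
      (tendsto_error_bound F hF (hKI hθ)).eventually_le_const hδ
  obtain ⟨s, hs, t, ht, hst⟩ := mem_prod_iff.1 hmem
  filter_upwards [hs] with n hn θ hθ
  have := hst (show (n, θ) ∈ s ×ˢ t from ⟨hn, subset_of_mem_nhdsSet ht hθ⟩)
  rwa [Set.mem_ofPred_eq] at this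

end LocalLimit

theorem mainTheorem3 {d : ℕ} (F : PMF (Fin d → ℤ)) (hF : LocalLimit.Aperiodic F)
    (hI : (LocalLimit.interiorDom F).Nonempty)
    -- under `P θ`, the variables `X 0, X 1, …` are independent with the tilted law `F_θ`
    {Ω : Type*} [MeasurableSpace Ω] (P : EuclideanSpace ℝ (Fin d) → Measure Ω)
    (X : ℕ → Ω → (Fin d → ℤ))
    (hindep : ∀ θ ∈ LocalLimit.interiorDom F, iIndepFun X (P θ))
    (hlaw : ∀ θ ∈ LocalLimit.interiorDom F, ∀ l, HasLaw (X l) (LocalLimit.tiltedLaw F θ) (P θ)) :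
    -- mean and covariance of `F_θ` exist, and `Σ_θ` is invertible
    (∀ θ ∈ LocalLimit.interiorDom F,
      MemLp LocalLimit.toEuclid 2 (LocalLimit.tiltedLaw F θ) ∧
        (LocalLimit.covMatrix F θ).PosDef) ∧
    ∀ K : Set (EuclideanSpace ℝ (Fin d)), IsCompact K → K ⊆ LocalLimit.interiorDom F →
      Tendsto
        (fun n : ℕ => ⨆ θ ∈ K, ⨆ s : Fin d → ℤ,
          ENNReal.ofReal
            |(n : ℝ) ^ ((d : ℝ) / 2) * (LocalLimit.covMatrix F θ).det ^ (1 / 2 : ℝ) *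
                (P θ).real {ω | ∑ l ∈ Finset.range n, X l ω = s} -
              (2 * Real.pi) ^ (-(d : ℝ) / 2) *
                Real.exp (-‖LocalLimit.zVec F n θ s‖ ^ 2 / 2)|)
        atTop (𝓝 0) := by
  refine ⟨fun θ hθ => ⟨LocalLimit.memLp_toEuclid F hθ, LocalLimit.posDef_covMatrix F hF hθ⟩,
    fun K hK hKI => ?_⟩
  rw [ENNReal.tendsto_nhds_zero]
  intro ε hε
  -- A real `δ` below `ε` is needed because `ε` may be infinite.
  obtain ⟨δ, hδ0, hδ⟩ := ENNReal.lt_iff_exists_real_btwn.1 hε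
  have hδpos : 0 < δ := by simpa using hδ.1
  have hev := LocalLimit.eventually_error_bound_le F hF hK hKI hδpos
  filter_upwards [hev, eventually_ge_atTop 1] with n h hn
  refine iSup₂_le fun θ hθ => iSup_le fun s => ?_
  refine (ENNReal.ofReal_le_ofReal ?_).trans hδ.2.le
  exact (LocalLimit.abs_sub_le_charFunError F hF (hKI hθ) (hindep θ (hKI hθ))
    (hlaw θ (hKI hθ)) hn s).trans (h θ hθ)
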